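/- Let $p$ be a prime and $n\ge 1$ with $p^n\equiv 3\pmod 4$ and $p^n>3$, let $\chi$ be the quadratic character of $\mathbb F_{p^n}$ (with $\chi(0)=0$), and put $$\lambda_{p,n}=\sum_{x\in\mathbb F_{p^n}}\chi\bigl(x(x^2+4x-1)\bigr)+\sum_{x\in\mathbb F_{p^n}}\chi\bigl(x(x^2-2x+5)\bigr).$$ For $F:\mathbb F_{p^n}\to\mathbb F_{p^n}$ and $a,b,c\in\mathbb F_{p^n}$ let ${}_c\delta_F(a,b)=|\{x: F(x+a)-cF(x)=b\}|$. The $c$-differential uniformity ${}_c\Delta_F$ is the maximum of ${}_c\delta_F(a,b)$ over all $a,b$ (with $a\neq0$ if $c=1$), and $F$ is called almost perfect $c$-nonlinear (AP$_c$N) if ${}_c\Delta_F=2$. Let ${}_c\omega_i=|\{b: {}_c\delta_F(1,b)=i\}|$. For a power function $F$, its $c$-differential spectrum is the multiset of those ${}_c\omega_i$, $0\le i\le {}_c\Delta_F$, that are positive. Let $F(x)=x^{(p^n-3)/2}$ on $\mathbb F_{p^n}$. Then $\chi(5)=\pm1$, and the $(-1)$-differential spectrum of $F$ is as follows. 1.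 If $\chi(5)=-1$, it is $$\Bigl\{{}_{-1}\omega_0=\tfrac{9p^n+\lambda_{p,n}-15}{16},\ {}_{-1}\omega_1=1,\ {}_{-1}\omega_2=\tfrac{3p^n-\lambda_{p,n}+3}{8},\ {}_{-1}\omega_4=\tfrac{p^n+\lambda_{p,n}-7}{16}\Bigr\}.$$ 2. If $\chi(5)=1$, it is $$\Bigl\{{}_{-1}\omega_0=\tfrac{9p^n+\lambda_{p,n}+9}{16},\ {}_{-1}\omega_2=\tfrac{3p^n-\lambda_{p,n}-13}{8},\ {}_{-1}\omega_3=1,\ {}_{-1}\omega_4=\tfrac{p^n+\lambda_{p,n}+1}{16}\Bigr\}.$$ Here all listed equalities hold, every ${}_{-1}\omega_i$ that is not listed is $0$, and listed entries that happen to be $0$ are omitted from the multiset. Moreover, the $(-1)$-differential uniformity of $F$ is $4$ if $p^n\notin\{7,27\}$, and $F$ is AP$_{-1}$N if $p^n\in\{7,27\}$. -/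

import Mathlib

/-- The entry `_cδ_F(a, b) = #{x : F (x + a) - c F x = b}` of the `c`-difference table of `F`. -/
def cDelta {K : Type*} [Field K] [Fintype K] [DecidableEq K] (F : K → K) (c a b : K) : ℕ :=
  (Finset.univ.filter fun x : K => F (x + a) - c * F x = b).card

/-- The `c`-differential uniformity: the maximum of `_cδ_F(a, b)` over all `a, b`, where `a ≠ 0` is
required if `c = 1`. -/
def cUniformity {K : Type*} [Field K] [Fintype K] [DecidableEq K] (F : K → K) (c : K) : ℕ :=
  (Finset.univ.filter fun ab : K × K => c = 1 → ab.1 ≠ 0).sup fun ab => cDelta F c ab.1 ab.2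

/-- `F` is almost perfect `c`-nonlinear: its `c`-differential uniformity is `2`. -/
def IsAPcN {K : Type*} [Field K] [Fintype K] [DecidableEq K] (F : K → K) (c : K) : Prop :=
  cUniformity F c = 2

/-- `_cω_i`: the number of `b` such that `_cδ_F(1, b) = i`. -/
def cOmega {K : Type*} [Field K] [Fintype K] [DecidableEq K] (F : K → K) (c : K) (i : ℕ) : ℕ :=
  (Finset.univ.filter fun b : K => cDelta F c 1 b = i).card

/-- The `c`-differential spectrum: the multiset of the `_cω_i`, for `0 ≤ i ≤ _cΔ_F`, that are
positive. -/
def cSpectrum {K : Type*} [Field K] [Fintype K] [DecidableEq K] (F : K → K) (c : K) :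
    Multiset ℕ :=
  ((Multiset.range (cUniformity F c + 1)).map (cOmega F c)).filter fun w => 0 < w

/-- The sum of `χ(x(x² + 4x - 1))` plus the sum of `χ(x(x² - 2x + 5))` over all `x` in `K`, where `χ`
is the quadratic character. -/
def lambdaSum (K : Type*) [Field K] [Fintype K] [DecidableEq K] : ℤ :=
  (∑ x : K, quadraticChar K (x * (x ^ 2 + 4 * x - 1))) +
    ∑ x : K, quadraticChar K (x * (x ^ 2 - 2 * x + 5))

/-- The power function `x ↦ x ^ ((q - 3) / 2)` on a finite field with `q` elements. -/
def powFun (K : Type*) [Field K] [Fintype K] : K → K :=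
  fun x => x ^ ((Fintype.card K - 3) / 2)

/-! Write `q` for the field size, `χ` for the quadratic character, `F = powFun K`, `α = alphaCount`,
`γ = gammaCount` and `δ(b)` for the number of solutions of `F(x+1) + F(x) = b`. Here `F(x) =
χ(x)/x`, an even function because `χ(-1) = -1`. Solutions with `χ(x) = χ(x+1) ≠ 0` are paired by `x
↦ -1-x` and number `2α(b)`; those with opposite characters number `γ(b)`; and `x = 0, -1` solve only
`b = 1`. So `δ(b) = 2α(b) + γ(b) + 2[b = 1]` (`cDelta_eq`).

Every `b ≠ 0` is `eβ²` with `e = ±1`, and then both counts are products of two factors `1 + χ(·)`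
(`alphaCount_formula`, `gammaCount_formula`). Hence `α ≤ 1`, and `γ` is `0` or `2` except at `b =
4χ(2)`, where it is `1`. Apart from the points `1` and `4χ(2)`, whose behaviour depends on `χ(5)`,
`δ(b) = 4` exactly when `αγ = 2`. So `ω₄` comes from `∑ αγ`, while `ω₀` and `ω₂` follow from `∑ ωᵢ =
∑ i ωᵢ = q`.

Adding `αγ` at `β²` and `-β²` kills all products of an odd number of characters. Inversion, affine
changes, sums over `x²` or `x⁴` and a 2-isogeny reduce the rest to the two cubic sums in `λ`
(`sum_alphaCount_mul_gammaCount`).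

The uniformity is `4` once `ω₄ > 0`, which follows from `q + λ > 7`. This needs a lower bound on
each cubic sum `S`, supplied by Hasse's bound in the form `q + kS + k² ≥ 0` (`hasse_bound`). It is
proved as Manin did: on the twisted curve over `K(t)` let `P` be the Frobenius point and `Q = (t,
1)`; heights obey a parallelogram inequality, `P` has height `q` and `P - Q` height at most `q + 1 +
S`, so `P - kQ` has height at most `q + kS + k²`. Taking `k = 5` settles `q > 27`. Smaller prime
fields are computed, and `q = 27` yields to congruences. -/

open Polynomial in
/-- The height of a rational function: the larger of the degrees of numerator and denominator. -/
noncomputable def RatFunc.height {K : Type*} [Field K] (r : RatFunc K) : ℕ :=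
  max r.num.natDegree r.denom.natDegree

/-! ### Heights of the two roots of a quadratic over `K(t)` -/

section Height

open Polynomial

variable {K : Type*} [Field K]

theorem RatFunc.height_algebraMap (f : K[X]) :
    (algebraMap K[X] (RatFunc K) f).height = f.natDegree := by
  simp [RatFunc.height]

theorem RatFunc.height_div_le (f : K[X]) {g : K[X]} (hg : g ≠ 0) :
    (algebraMap K[X] (RatFunc K) f / algebraMap K[X] (RatFunc K) g).height ≤
      max f.natDegree g.natDegree := by
  rcases eq_or_ne f 0 with rfl | hf
  · simp [RatFunc.height]
  · exact max_le_max (natDegree_le_of_dvd (RatFunc.num_div_dvd f hg) hf)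
      (natDegree_le_of_dvd (RatFunc.denom_div_dvd f g) hg)

/-- A form of Gauss's lemma: the product of the primitive polynomials `BT - A` and `DT - C` is
primitive, so `BD`, which divides `M` times each of its coefficients, divides `M`. The proof is an
explicit Bézout computation. -/
theorem Polynomial.mul_dvd_of_symmetric_ratio {A B C D M N₀ N₁ : K[X]} (h₁ : IsCoprime A B)
    (h₂ : IsCoprime C D) (hD₀ : B * D * N₀ = M * (A * C))
    (hD₁ : B * D * N₁ = M * (A * D + C * B)) : B * D ∣ M := by
  obtain ⟨u, v, huv⟩ := h₁
  obtain ⟨w, z, hwz⟩ := h₂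
  -- Put `ε = (uz - vw)AD`. Modulo `BD`, `M(1 - ε)` vanishes by expanding `(uA + vB)(wC + zD) = 1`,
  -- and `Mε²` vanishes because `AD · CB = AC · BD`; then `1 = (1 - ε)(1 + ε) + ε²`.
  have e₁ : M * (1 - (u * z - v * w) * (A * D)) =
      B * D * (u * w * N₀ + v * w * N₁ + v * z * M) := by
    linear_combination (-M) * (u * A + v * B) * hwz - M * huv - u * w * hD₀ - v * w * hD₁
  have e₂ : M * (A * D) ^ 2 = B * D * (N₁ * (A * D) - M * (A * C)) := by
    linear_combination (-(A * D)) * hD₁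
  refine ⟨(1 + (u * z - v * w) * (A * D)) * (u * w * N₀ + v * w * N₁ + v * z * M) +
    (u * z - v * w) ^ 2 * (N₁ * (A * D) - M * (A * C)), ?_⟩
  linear_combination (1 + (u * z - v * w) * (A * D)) * e₁ + (u * z - v * w) ^ 2 * e₂

/-- The counterpart of Gauss's lemma at infinity. If the two summands of the middle coefficient have
different degrees, nothing cancels there; if they agree, then `deg A - deg B = deg C - deg D`, and
an outer coefficient attains the maximum. -/
theorem Polynomial.max_natDegree_add_max_natDegree_le {A B C D : K[X]} {d : ℕ} (hB : B ≠ 0)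
    (hD : D ≠ 0) (h₀ : (A * C).natDegree ≤ d) (h₁ : (A * D + C * B).natDegree ≤ d)
    (h₂ : (B * D).natDegree ≤ d) :
    max A.natDegree B.natDegree + max C.natDegree D.natDegree ≤ d := by
  rw [natDegree_mul hB hD] at h₂
  rcases eq_or_ne A 0 with rfl | hA
  · rcases eq_or_ne C 0 with rfl | hC
    · simpa using h₂
    · rw [zero_mul, zero_add, natDegree_mul hC hB] at h₁
      simp only [natDegree_zero]
      omega
  rcases eq_or_ne C 0 with rfl | hC
  · rw [zero_mul, add_zero, natDegree_mul hA hD] at h₁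
    simp only [natDegree_zero]
    omega
  rw [natDegree_mul hA hC] at h₀
  have e₁ := natDegree_mul hA hD
  have e₂ := natDegree_mul hC hB
  rcases lt_trichotomy (A * D).natDegree (C * B).natDegree with h | h | h
  · rw [natDegree_add_eq_right_of_natDegree_lt h] at h₁
    omega
  · omega
  · rw [natDegree_add_eq_left_of_natDegree_lt h] at h₁
    omega

/-- Two rational functions that are the roots of `M T² - N₁ T + N₀` have heights adding up to at
most the degree of that polynomial in the coefficients. -/
theorem RatFunc.height_add_height_le {r s : RatFunc K} {M N₀ N₁ : K[X]} {d : ℕ} (hM : M ≠ 0)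
    (hsum : algebraMap K[X] (RatFunc K) M * (r + s) = algebraMap K[X] (RatFunc K) N₁)
    (hprod : algebraMap K[X] (RatFunc K) M * (r * s) = algebraMap K[X] (RatFunc K) N₀)
    (hdM : M.natDegree ≤ d) (hd₀ : N₀.natDegree ≤ d) (hd₁ : N₁.natDegree ≤ d) :
    r.height + s.height ≤ d := by
  have hinj := RatFunc.algebraMap_injective K
  have hr := RatFunc.num_div_denom r
  have hs := RatFunc.num_div_denom s
  have hB := r.denom_ne_zero
  have hD := s.denom_ne_zero
  have hB' : algebraMap K[X] (RatFunc K) r.denom ≠ 0 := RatFunc.algebraMap_ne_zero hB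
  have hD' : algebraMap K[X] (RatFunc K) s.denom ≠ 0 := RatFunc.algebraMap_ne_zero hD
  have hr' : algebraMap K[X] (RatFunc K) r.num = r * algebraMap K[X] (RatFunc K) r.denom := by
    rw [← div_eq_iff hB', hr]
  have hs' : algebraMap K[X] (RatFunc K) s.num = s * algebraMap K[X] (RatFunc K) s.denom := by
    rw [← div_eq_iff hD', hs]
  have e₀ : r.denom * s.denom * N₀ = M * (r.num * s.num) := by
    apply hinj
    simp only [map_mul, ← hprod, hr', hs']
    ring
  have e₁ : r.denom * s.denom * N₁ = M * (r.num * s.denom + s.num * r.denom) := by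
    apply hinj
    simp only [map_mul, map_add, ← hsum, hr', hs']
    ring
  obtain ⟨g, hg⟩ := mul_dvd_of_symmetric_ratio r.isCoprime_num_denom s.isCoprime_num_denom e₀ e₁
  have hg0 : g ≠ 0 := by
    rintro rfl
    exact hM (by simpa using hg)
  have hBD := mul_ne_zero hB hD
  have e₀' : N₀ = g * (r.num * s.num) := by
    apply mul_left_cancel₀ hBD
    rw [e₀, hg]
    ring
  have e₁' : N₁ = g * (r.num * s.denom + s.num * r.denom) := by
    apply mul_left_cancel₀ hBD
    rw [e₁, hg]
    ring
  have key : ∀ f N : K[X], N = g * f → N.natDegree ≤ d → f.natDegree ≤ d := by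
    rintro f N rfl h
    rcases eq_or_ne f 0 with rfl | hf
    · simp
    · rw [natDegree_mul hg0 hf] at h
      omega
  exact max_natDegree_add_max_natDegree_le hB hD (key _ _ e₀' hd₀) (key _ _ e₁' hd₁)
    (key _ _ (by rw [hg]; ring) hdM)

end Height

/-! ### Sum and product of the abscissae of `P + Q` and `P - Q` -/

section AdditionFormula

variable {L : Type*} [Field L] {A B x₁ x₂ y₁ y₂ : L}

theorem sum_add_sub_abscissae (hx : x₁ ≠ x₂) (h₁ : y₁ ^ 2 = x₁ ^ 3 + A * x₁ ^ 2 + B * x₁)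
    (h₂ : y₂ ^ 2 = x₂ ^ 3 + A * x₂ ^ 2 + B * x₂) :
    (x₁ - x₂) ^ 2 * ((((y₁ - y₂) / (x₁ - x₂)) ^ 2 - A - x₁ - x₂) +
      (((y₁ + y₂) / (x₁ - x₂)) ^ 2 - A - x₁ - x₂)) =
      2 * ((x₁ * x₂ + B) * (x₁ + x₂) + 2 * A * (x₁ * x₂)) := by
  have h := sub_ne_zero.mpr hx
  field_simp
  linear_combination 2 * h₁ + 2 * h₂

theorem prod_add_sub_abscissae (hx : x₁ ≠ x₂) (h₁ : y₁ ^ 2 = x₁ ^ 3 + A * x₁ ^ 2 + B * x₁)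
    (h₂ : y₂ ^ 2 = x₂ ^ 3 + A * x₂ ^ 2 + B * x₂) :
    (x₁ - x₂) ^ 2 * ((((y₁ - y₂) / (x₁ - x₂)) ^ 2 - A - x₁ - x₂) *
      (((y₁ + y₂) / (x₁ - x₂)) ^ 2 - A - x₁ - x₂)) = (x₁ * x₂ - B) ^ 2 := by
  have h := sub_ne_zero.mpr hx
  have e : ((y₁ - y₂) / (x₁ - x₂)) ^ 2 * ((y₁ + y₂) / (x₁ - x₂)) ^ 2 * (x₁ - x₂) ^ 4 =
      (x₁ ^ 3 + A * x₁ ^ 2 + B * x₁ - (x₂ ^ 3 + A * x₂ ^ 2 + B * x₂)) ^ 2 := by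
    rw [← h₁, ← h₂]
    field_simp
    ring
  have e' : (((y₁ - y₂) / (x₁ - x₂)) ^ 2 + ((y₁ + y₂) / (x₁ - x₂)) ^ 2) * (x₁ - x₂) ^ 2 =
      2 * (x₁ ^ 3 + A * x₁ ^ 2 + B * x₁ + (x₂ ^ 3 + A * x₂ ^ 2 + B * x₂)) := by
    rw [← h₁, ← h₂]
    field_simp
    ring
  apply mul_left_cancel₀ (pow_ne_zero 2 h)
  linear_combination e - (A + x₁ + x₂) * (x₁ - x₂) ^ 2 * e'

end AdditionFormula

/-! ### The quadratic twist over `K(t)` and the height of its points -/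

section Curve

open Polynomial WeierstrassCurve.Affine

variable {K : Type*} [Field K]

/-- The cubic polynomial `X³ + aX² + bX`. -/
noncomputable def cubicPoly (a b : K) : K[X] := X ^ 3 + C a * X ^ 2 + C b * X

/-- The quadratic twist of `y² = x³ + ax² + bx` by `D = t³ + at² + bt` over `K(t)`. -/
noncomputable def twistCurve (a b : K) : WeierstrassCurve.Affine (RatFunc K) :=
  let D := algebraMap K[X] (RatFunc K) (cubicPoly a b)
  ⟨0, algebraMap K[X] (RatFunc K) (C a) * D, 0, algebraMap K[X] (RatFunc K) (C b) * D ^ 2, 0⟩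

theorem cubicPoly_natDegree (a b : K) : (cubicPoly a b).natDegree = 3 := by
  unfold cubicPoly
  compute_degree!

theorem cubicPoly_ne_zero (a b : K) : cubicPoly a b ≠ 0 := by
  intro h
  have := cubicPoly_natDegree a b
  simp [h] at this

theorem algebraMap_cubicPoly_ne_zero (a b : K) :
    algebraMap K[X] (RatFunc K) (cubicPoly a b) ≠ 0 :=
  RatFunc.algebraMap_ne_zero (cubicPoly_ne_zero a b)

theorem twistCurve_equation (a b : K) (x y : RatFunc K) :
    (twistCurve a b).Equation x y ↔ y ^ 2 = x ^ 3 +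
      algebraMap K[X] (RatFunc K) (C a) * algebraMap K[X] (RatFunc K) (cubicPoly a b) * x ^ 2 +
      algebraMap K[X] (RatFunc K) (C b) * algebraMap K[X] (RatFunc K) (cubicPoly a b) ^ 2 * x := by
  rw [WeierstrassCurve.Affine.equation_iff]
  simp [twistCurve]

theorem twistCurve_nonsingular {a b : K} (h2 : (2 : K) ≠ 0) (hb : b ≠ 0)
    (hab : a ^ 2 - 4 * b ≠ 0) {x y : RatFunc K} (h : (twistCurve a b).Equation x y) :
    (twistCurve a b).Nonsingular x y := by
  apply (equation_iff_nonsingular_of_Δ_ne_zero ?_).mp h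
  have e : (twistCurve a b).Δ = algebraMap K[X] (RatFunc K)
      (C (2 ^ 4 * b ^ 2 * (a ^ 2 - 4 * b)) * cubicPoly a b ^ 6) := by
    simp only [twistCurve, WeierstrassCurve.Δ, WeierstrassCurve.b₂, WeierstrassCurve.b₄,
      WeierstrassCurve.b₆, WeierstrassCurve.b₈, map_mul, map_pow, map_sub, map_ofNat]
    ring
  rw [e]
  apply RatFunc.algebraMap_ne_zero
  refine mul_ne_zero ?_ (pow_ne_zero _ (cubicPoly_ne_zero a b))
  rw [Ne, C_eq_zero]
  exact mul_ne_zero (mul_ne_zero (pow_ne_zero _ h2) (pow_ne_zero _ hb)) hab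

/-- The height of the untwisted abscissa of a point of the twisted curve. -/
noncomputable def pointHeight (a b : K) : (twistCurve a b).Point → ℕ
  | .zero => 0
  | .some x _ _ => (x / algebraMap K[X] (RatFunc K) (cubicPoly a b)).height

theorem pointHeight_zero (a b : K) : pointHeight a b 0 = 0 := rfl

theorem pointHeight_some (a b : K) {x y : RatFunc K} (h : (twistCurve a b).Nonsingular x y) :
    pointHeight a b (.some x y h) =
      (x / algebraMap K[X] (RatFunc K) (cubicPoly a b)).height := rfl

theorem pointHeight_neg (a b : K) (P : (twistCurve a b).Point) :
    pointHeight a b (-P) = pointHeight a b P := by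
  cases P <;> rfl

end Curve

/-! ### The parallelogram inequality for translation by `(t, 1)` -/

section Parallelogram

open Polynomial WeierstrassCurve.Affine

variable {K : Type*} [Field K]

theorem RatFunc.two_ne_zero_of (h2 : (2 : K) ≠ 0) : (2 : RatFunc K) ≠ 0 := by
  have h := RatFunc.algebraMap_ne_zero (C_ne_zero.mpr h2)
  rwa [map_ofNat, map_ofNat] at h

/-- The untwisted abscissae of `P ± Q` are the roots of a quadratic whose coefficients, after
clearing the denominator of `x`, are polynomials of degree at most `2(h(x) + 1)`;
`RatFunc.height_add_height_le` then applies. -/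
theorem height_add_height_twist_le {a b : K} {x y₁ y₂ : RatFunc K}
    (hx : x ≠ algebraMap K[X] (RatFunc K) X)
    {D : RatFunc K} (hD : D ≠ 0)
    (h₁ : y₁ ^ 2 = (D * x) ^ 3 + algebraMap K[X] (RatFunc K) (C a) * D * (D * x) ^ 2 +
      algebraMap K[X] (RatFunc K) (C b) * D ^ 2 * (D * x))
    (h₂ : y₂ ^ 2 = (D * algebraMap K[X] (RatFunc K) X) ^ 3 +
      algebraMap K[X] (RatFunc K) (C a) * D * (D * algebraMap K[X] (RatFunc K) X) ^ 2 +
      algebraMap K[X] (RatFunc K) (C b) * D ^ 2 * (D * algebraMap K[X] (RatFunc K) X)) :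
    RatFunc.height ((((y₁ - y₂) / (D * x - D * algebraMap K[X] (RatFunc K) X)) ^ 2 -
        algebraMap K[X] (RatFunc K) (C a) * D - D * x - D * algebraMap K[X] (RatFunc K) X) / D) +
      RatFunc.height ((((y₁ + y₂) / (D * x - D * algebraMap K[X] (RatFunc K) X)) ^ 2 -
        algebraMap K[X] (RatFunc K) (C a) * D - D * x - D * algebraMap K[X] (RatFunc K) X) / D) ≤
      2 * x.height + 2 := by
  have hne : D * x ≠ D * algebraMap K[X] (RatFunc K) X := fun h ↦ hx (mul_left_cancel₀ hD h)
  have hs := sum_add_sub_abscissae hne h₁ h₂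
  have hp := prod_add_sub_abscissae hne h₁ h₂
  set u := ((y₁ - y₂) / (D * x - D * algebraMap K[X] (RatFunc K) X)) ^ 2 -
        algebraMap K[X] (RatFunc K) (C a) * D - D * x - D * algebraMap K[X] (RatFunc K) X
  set v := ((y₁ + y₂) / (D * x - D * algebraMap K[X] (RatFunc K) X)) ^ 2 -
        algebraMap K[X] (RatFunc K) (C a) * D - D * x - D * algebraMap K[X] (RatFunc K) X
  have hB' : algebraMap K[X] (RatFunc K) x.denom ≠ 0 := RatFunc.algebraMap_ne_zero x.denom_ne_zero
  have hr : algebraMap K[X] (RatFunc K) x.num = x * algebraMap K[X] (RatFunc K) x.denom := by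
    rw [← div_eq_iff hB', RatFunc.num_div_denom]
  clear_value u v
  obtain ⟨u, rfl⟩ : ∃ u', u = D * u' := ⟨u / D, by field_simp⟩
  obtain ⟨v, rfl⟩ : ∃ v', v = D * v' := ⟨v / D, by field_simp⟩
  rw [mul_div_cancel_left₀ _ hD, mul_div_cancel_left₀ _ hD]
  have hs' : (x - algebraMap K[X] (RatFunc K) X) ^ 2 * (u + v) =
      2 * ((x * algebraMap K[X] (RatFunc K) X + algebraMap K[X] (RatFunc K) (C b)) *
        (x + algebraMap K[X] (RatFunc K) X) +
        2 * algebraMap K[X] (RatFunc K) (C a) * (x * algebraMap K[X] (RatFunc K) X)) := by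
    -- The sum identity is homogeneous of degree 3 in the twisting factor `D`, and the product
    -- identity below of degree 4.
    apply mul_left_cancel₀ (pow_ne_zero 3 hD)
    linear_combination hs
  have hp' : (x - algebraMap K[X] (RatFunc K) X) ^ 2 * (u * v) =
      (x * algebraMap K[X] (RatFunc K) X - algebraMap K[X] (RatFunc K) (C b)) ^ 2 := by
    apply mul_left_cancel₀ (pow_ne_zero 4 hD)
    linear_combination hp
  have hN : x.num.natDegree ≤ x.height := le_max_left _ _
  have hM : x.denom.natDegree ≤ x.height := le_max_right _ _
  have hX : (X : K[X]).natDegree ≤ 1 := natDegree_X_le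
  have hXB : (X * x.denom).natDegree ≤ x.height + 1 := by
    refine natDegree_mul_le.trans ?_
    omega
  have hNX : (x.num * X).natDegree ≤ x.height + 1 := by
    refine natDegree_mul_le.trans ?_
    omega
  have hbB : (C b * x.denom).natDegree ≤ x.height + 1 := (natDegree_C_mul_le _ _).trans (by omega)
  have d₁ : (x.num - X * x.denom).natDegree ≤ x.height + 1 :=
    natDegree_sub_le_of_le (by omega) hXB |>.trans (by simp)
  have d₁' : (x.num + X * x.denom).natDegree ≤ x.height + 1 :=
    natDegree_add_le_of_degree_le (by omega) hXB
  have d₂ : (x.num * X - C b * x.denom).natDegree ≤ x.height + 1 :=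
    natDegree_sub_le_of_le hNX hbB |>.trans (by simp)
  have d₃ : (x.num * X + C b * x.denom).natDegree ≤ x.height + 1 :=
    natDegree_add_le_of_degree_le hNX hbB
  refine RatFunc.height_add_height_le (M := (x.num - X * x.denom) ^ 2)
    (N₀ := (x.num * X - C b * x.denom) ^ 2)
    (N₁ := C 2 * ((x.num * X + C b * x.denom) * (x.num + X * x.denom) +
      C (2 * a) * (x.num * (X * x.denom)))) (pow_ne_zero _ ?_) ?_ ?_
      (natDegree_pow_le.trans (by omega)) (natDegree_pow_le.trans (by omega)) ?_
  · intro h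
    apply hx
    have := congrArg (algebraMap K[X] (RatFunc K)) h
    rw [map_sub, map_mul, hr, map_zero, ← sub_mul] at this
    exact sub_eq_zero.mp ((mul_eq_zero.mp this).resolve_right hB')
  · simp only [map_mul, map_pow, map_sub, map_add, hr, map_ofNat]
    linear_combination (algebraMap K[X] (RatFunc K) x.denom) ^ 2 * hs'
  · simp only [map_mul, map_pow, map_sub, hr]
    linear_combination (algebraMap K[X] (RatFunc K) x.denom) ^ 2 * hp'
  · refine (natDegree_C_mul_le _ _).trans (natDegree_add_le_of_degree_le ?_ ?_)
    · exact natDegree_mul_le.trans (by omega)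
    · exact (natDegree_C_mul_le _ _).trans (natDegree_mul_le.trans (by omega))

/-- The abscissa `(t² - b)² / (4 D)` of twice the point `(t, 1)`. -/
theorem height_double_le {a b : K} (h2 : (2 : K) ≠ 0) {D : RatFunc K}
    (hD : D = algebraMap K[X] (RatFunc K) (cubicPoly a b)) (hD0 : D ≠ 0) :
    RatFunc.height ((((3 * (D * algebraMap K[X] (RatFunc K) X) ^ 2 +
      2 * (algebraMap K[X] (RatFunc K) (C a) * D) * (D * algebraMap K[X] (RatFunc K) X) +
      algebraMap K[X] (RatFunc K) (C b) * D ^ 2) / (D ^ 2 + D ^ 2)) ^ 2 -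
      algebraMap K[X] (RatFunc K) (C a) * D - D * algebraMap K[X] (RatFunc K) X -
      D * algebraMap K[X] (RatFunc K) X) / D) ≤ 4 := by
  have h2' := RatFunc.two_ne_zero_of h2
  have h4 : C (4 : K) * cubicPoly a b ≠ 0 := by
    refine mul_ne_zero (C_ne_zero.mpr ?_) (cubicPoly_ne_zero a b)
    rw [show (4 : K) = 2 * 2 by norm_num]
    exact mul_ne_zero h2 h2
  have e : (((3 * (D * algebraMap K[X] (RatFunc K) X) ^ 2 +
      2 * (algebraMap K[X] (RatFunc K) (C a) * D) * (D * algebraMap K[X] (RatFunc K) X) +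
      algebraMap K[X] (RatFunc K) (C b) * D ^ 2) / (D ^ 2 + D ^ 2)) ^ 2 -
      algebraMap K[X] (RatFunc K) (C a) * D - D * algebraMap K[X] (RatFunc K) X -
      D * algebraMap K[X] (RatFunc K) X) / D =
      algebraMap K[X] (RatFunc K) ((X ^ 2 - C b) ^ 2) /
        algebraMap K[X] (RatFunc K) (C 4 * cubicPoly a b) := by
    have hD' : D = algebraMap K[X] (RatFunc K) X ^ 3 + algebraMap K[X] (RatFunc K) (C a) *
        algebraMap K[X] (RatFunc K) X ^ 2 +
        algebraMap K[X] (RatFunc K) (C b) * algebraMap K[X] (RatFunc K) X := by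
      simp [hD, cubicPoly]
    simp only [map_mul, ← hD, map_pow, map_sub, map_ofNat]
    rw [← two_mul]
    have h4' : (4 : RatFunc K) ≠ 0 := by
      rw [show (4 : RatFunc K) = 2 * 2 by norm_num]
      exact mul_ne_zero h2' h2'
    generalize algebraMap K[X] (RatFunc K) X = t at *
    generalize algebraMap K[X] (RatFunc K) (C a) = a' at *
    generalize algebraMap K[X] (RatFunc K) (C b) = b' at *
    field_simp
    rw [hD']
    ring
  rw [e]
  refine (RatFunc.height_div_le _ h4).trans (max_le ?_ ?_)
  · refine natDegree_pow_le.trans ?_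
    have : (X ^ 2 - C b : K[X]).natDegree ≤ 2 := by compute_degree
    omega
  · refine (natDegree_C_mul_le _ _).trans ?_
    rw [cubicPoly_natDegree]
    norm_num

theorem twistCurve_equation_twistPoint (a b : K) : (twistCurve a b).Equation
    (algebraMap K[X] (RatFunc K) (cubicPoly a b) * algebraMap K[X] (RatFunc K) X)
    (algebraMap K[X] (RatFunc K) (cubicPoly a b) ^ 2) := by
  rw [twistCurve_equation]
  have hD' : algebraMap K[X] (RatFunc K) (cubicPoly a b) =
      algebraMap K[X] (RatFunc K) X ^ 3 + algebraMap K[X] (RatFunc K) (C a) *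
        algebraMap K[X] (RatFunc K) X ^ 2 +
        algebraMap K[X] (RatFunc K) (C b) * algebraMap K[X] (RatFunc K) X := by
    simp [cubicPoly]
  linear_combination (algebraMap K[X] (RatFunc K) (cubicPoly a b)) ^ 3 * hD'

/-- The point `(t, 1)` of the twisted curve. -/
noncomputable def twistPoint {a b : K} (h2 : (2 : K) ≠ 0) (hb : b ≠ 0)
    (hab : a ^ 2 - 4 * b ≠ 0) : (twistCurve a b).Point :=
  .some _ _ (twistCurve_nonsingular h2 hb hab (twistCurve_equation_twistPoint a b))

variable {a b : K} (h2 : (2 : K) ≠ 0) (hb : b ≠ 0) (hab : a ^ 2 - 4 * b ≠ 0)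

theorem pointHeight_twistPoint : pointHeight a b (twistPoint h2 hb hab) = 1 := by
  rw [twistPoint, pointHeight_some, mul_div_cancel_left₀ _ (algebraMap_cubicPoly_ne_zero a b),
    RatFunc.height_algebraMap, natDegree_X]

theorem pointHeight_double_le [DecidableEq (RatFunc K)] :
    pointHeight a b (twistPoint h2 hb hab + twistPoint h2 hb hab) ≤ 4 := by
  have hD := algebraMap_cubicPoly_ne_zero a b
  have h2' := RatFunc.two_ne_zero_of h2
  have hY : algebraMap K[X] (RatFunc K) (cubicPoly a b) ^ 2 ≠ (twistCurve a b).negY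
      (algebraMap K[X] (RatFunc K) (cubicPoly a b) * algebraMap K[X] (RatFunc K) X)
      (algebraMap K[X] (RatFunc K) (cubicPoly a b) ^ 2) := by
    intro h
    simp only [negY, twistCurve, zero_mul, sub_zero] at h
    have : 2 * algebraMap K[X] (RatFunc K) (cubicPoly a b) ^ 2 = 0 := by linear_combination h
    exact mul_ne_zero h2' (pow_ne_zero 2 hD) this
  rw [twistPoint, Point.add_self_of_Y_ne hY, pointHeight_some, slope_of_Y_ne rfl hY]
  convert height_double_le (a := a) (b := b) h2 rfl hD using 3
  simp [addX, negY, twistCurve]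

/-- Since `(t, 1)` has height 1, this is half of the parallelogram law for the height, and the only
half that the induction in `hasse_bound` needs. -/
theorem pointHeight_add_add_pointHeight_sub_le [DecidableEq (RatFunc K)]
    (P : (twistCurve a b).Point) :
    pointHeight a b (P + twistPoint h2 hb hab) + pointHeight a b (P - twistPoint h2 hb hab) ≤
      2 * pointHeight a b P + 2 := by
  have hD := algebraMap_cubicPoly_ne_zero a b
  have hQ := pointHeight_twistPoint h2 hb hab
  have hQ2 := pointHeight_double_le h2 hb hab
  -- Outside these cases `P` and `Q` have different abscissae, so both `P + Q` and `P - Q` are given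
  -- by the chord formula. For `P = ±Q` the doubled point has height at most `4`, exactly the
  -- right-hand side.
  by_cases h : P = 0 ∨ P = twistPoint h2 hb hab ∨ P = -twistPoint h2 hb hab
  · rcases h with rfl | rfl | rfl
    · rw [zero_add, zero_sub, pointHeight_neg, hQ]
      omega
    · rw [sub_self, pointHeight_zero, hQ]
      omega
    · rw [neg_add_cancel, pointHeight_zero, ← neg_add', pointHeight_neg, pointHeight_neg, hQ]
      omega
  push Not at h
  obtain ⟨h0, hP, hP'⟩ := h
  rcases P with _ | ⟨x, y, hxy⟩
  · exact absurd rfl h0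
  have hx : x ≠ algebraMap K[X] (RatFunc K) (cubicPoly a b) * algebraMap K[X] (RatFunc K) X := by
    intro hx
    rw [twistPoint] at hP hP'
    rcases Point.X_eq_iff.mp hx with h | h
    · exact hP h
    · exact hP' h
  obtain ⟨z, rfl⟩ : ∃ z, x = algebraMap K[X] (RatFunc K) (cubicPoly a b) * z :=
    ⟨x / algebraMap K[X] (RatFunc K) (cubicPoly a b), by field_simp⟩
  have e₁ := (twistCurve_equation a b _ _).mp hxy.1
  have e₂ := (twistCurve_equation a b _ _).mp (twistCurve_equation_twistPoint a b)
  have key := height_add_height_twist_le (x := z) (fun h ↦ hx (by rw [h])) hD e₁ e₂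
  rw [sub_eq_add_neg, twistPoint, Point.neg_some, Point.add_of_X_ne hx, Point.add_of_X_ne hx]
  simp only [pointHeight_some, slope_of_X_ne hx, addX, negY]
  simp only [twistCurve, zero_mul, sub_zero, add_zero, sub_neg_eq_add]
  rw [mul_div_cancel_left₀ _ hD]
  exact key

end Parallelogram

/-! ### The Frobenius point and Hasse's bound -/

section Frobenius

open Polynomial WeierstrassCurve.Affine

variable {K : Type*} [Field K]

theorem eval_cubicPoly (a b x : K) : (cubicPoly a b).eval x = x * (x ^ 2 + a * x + b) := by
  simp [cubicPoly]
  ring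

variable [Fintype K]

theorem cubicPoly_pow_card (a b : K) : cubicPoly a b ^ Fintype.card K =
    X ^ (3 * Fintype.card K) + C a * X ^ (2 * Fintype.card K) + C b * X ^ Fintype.card K := by
  rw [← FiniteField.expand_card]
  simp only [cubicPoly, map_add, map_mul, map_pow, expand_X, expand_C]
  ring

/-- The numerator of the abscissa of the difference of the Frobenius point and `(t, 1)`. -/
noncomputable def frobNum (a b : K) (m : ℕ) : K[X] :=
  cubicPoly a b * (cubicPoly a b ^ m + 1) ^ 2 -
    (C a + X ^ Fintype.card K + X) * (X ^ Fintype.card K - X) ^ 2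

/-- The terms `X^(3q)` and `a X^(2q)` cancel, because `D^(2m+1) = D^q` is `D` evaluated at `X^q`. -/
theorem natDegree_frobNum_le (a b : K) {m : ℕ} (hm : 2 * m + 1 = Fintype.card K) :
    (frobNum a b m).natDegree ≤ 2 * Fintype.card K + 1 := by
  have hq := Fintype.one_lt_card (α := K)
  have e : frobNum a b m = X ^ (2 * Fintype.card K + 1) + C b * X ^ Fintype.card K +
      C 2 * cubicPoly a b ^ (m + 1) + cubicPoly a b + X ^ (Fintype.card K + 2) +
      C (2 * a) * X ^ (Fintype.card K + 1) - C a * X ^ 2 - X ^ 3 := by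
    have h := cubicPoly_pow_card a b
    rw [frobNum]
    generalize Fintype.card K = q at *
    subst hm
    simp only [map_mul, map_ofNat]
    rw [show (cubicPoly a b) * (cubicPoly a b ^ m + 1) ^ 2 = cubicPoly a b ^ (2 * m + 1) +
      2 * cubicPoly a b ^ (m + 1) + cubicPoly a b by ring, h]
    ring
  have hadd : ∀ f g : K[X], f.natDegree ≤ 2 * Fintype.card K + 1 →
      g.natDegree ≤ 2 * Fintype.card K + 1 → (f + g).natDegree ≤ 2 * Fintype.card K + 1 :=
    fun f g hf hg ↦ natDegree_add_le_of_degree_le hf hg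
  have hsub : ∀ f g : K[X], f.natDegree ≤ 2 * Fintype.card K + 1 →
      g.natDegree ≤ 2 * Fintype.card K + 1 → (f - g).natDegree ≤ 2 * Fintype.card K + 1 :=
    fun f g hf hg ↦ (natDegree_sub_le f g).trans (max_le hf hg)
  have hf : (C 2 * cubicPoly a b ^ (m + 1)).natDegree ≤ 2 * Fintype.card K + 1 := by
    refine (natDegree_C_mul_le _ _).trans (natDegree_pow_le.trans ?_)
    rw [cubicPoly_natDegree]
    omega
  have hX : ∀ k ≤ 2 * Fintype.card K + 1,
      (X ^ k : K[X]).natDegree ≤ 2 * Fintype.card K + 1 := by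
    intro k hk
    rwa [natDegree_X_pow]
  have hCX : ∀ (c : K), ∀ k ≤ 2 * Fintype.card K + 1,
      (C c * X ^ k : K[X]).natDegree ≤ 2 * Fintype.card K + 1 :=
    fun c k hk ↦ (natDegree_C_mul_le _ _).trans (hX k hk)
  have hc : (cubicPoly a b).natDegree ≤ 2 * Fintype.card K + 1 := by
    rw [cubicPoly_natDegree]
    omega
  rw [e]
  exact hsub _ _ (hsub _ _ (hadd _ _ (hadd _ _ (hadd _ _ (hadd _ _ (hadd _ _
    (hX _ le_rfl) (hCX _ _ (by omega))) hf) hc) (hX _ (by omega))) (hCX _ _ (by omega)))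
    (hCX _ _ (by omega))) (hX _ (by omega))

theorem X_sub_C_dvd_X_pow_card_sub_X (α : K) : X - C α ∣ X ^ Fintype.card K - (X : K[X]) := by
  rw [dvd_iff_isRoot, IsRoot, eval_sub, eval_pow, eval_X, FiniteField.pow_card, sub_self]

theorem twistCurve_equation_frobenius (a b : K) {m : ℕ} (hm : 2 * m + 1 = Fintype.card K) :
    (twistCurve a b).Equation
      (algebraMap K[X] (RatFunc K) (cubicPoly a b) *
        algebraMap K[X] (RatFunc K) (X ^ Fintype.card K))
      (algebraMap K[X] (RatFunc K) (cubicPoly a b) ^ 2 *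
        algebraMap K[X] (RatFunc K) (cubicPoly a b ^ m)) := by
  rw [twistCurve_equation]
  have h := congrArg (algebraMap K[X] (RatFunc K)) (cubicPoly_pow_card a b)
  rw [← hm] at h ⊢
  simp only [map_add, map_mul, map_pow] at h ⊢
  linear_combination algebraMap K[X] (RatFunc K) (cubicPoly a b) ^ 3 * h

variable [DecidableEq K]

/-- The multiplicity with which `X - α` cancels from numerator and denominator. -/
noncomputable def cancelMult (a b α : K) : ℕ :=
  (1 - quadraticChar K (α * (α ^ 2 + a * α + b))).toNat

theorem cancelMult_cast (a b α : K) :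
    (cancelMult a b α : ℤ) = 1 - quadraticChar K (α * (α ^ 2 + a * α + b)) := by
  apply Int.toNat_of_nonneg
  rcases quadraticChar_isQuadratic K (α * (α ^ 2 + a * α + b)) with h | h | h <;> simp [h]

/-- By Euler's criterion `D(α)^m = χ(D(α))`. If this is `-1`, then `α` is a root of `D^m + 1`, which
occurs squared; if `D(α) = 0`, the factor `D` contributes one root; otherwise no cancellation is
claimed. -/
theorem cancelMult_dvd {a b : K} {m : ℕ} (hm : 2 * m + 1 = Fintype.card K)
    (h2 : ringChar K ≠ 2) (α : K) :
    (X - C α) ^ cancelMult a b α ∣ cubicPoly a b * (cubicPoly a b ^ m + 1) ^ 2 ∧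
    cancelMult a b α ≤ 2 := by
  have hc := cancelMult_cast a b α
  have hp := quadraticChar_eq_pow_of_char_ne_two' h2 (α * (α ^ 2 + a * α + b))
  rw [show Fintype.card K / 2 = m by omega] at hp
  rcases quadraticChar_isQuadratic K (α * (α ^ 2 + a * α + b)) with h | h | h
  · rw [h] at hc
    have h1 : cancelMult a b α = 1 := by omega
    rw [h1, pow_one]
    refine ⟨Dvd.dvd.mul_right ?_ _, by omega⟩
    rw [dvd_iff_isRoot, IsRoot, eval_cubicPoly]
    exact quadraticChar_eq_zero_iff.mp h
  · rw [h] at hc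
    have h1 : cancelMult a b α = 0 := by omega
    simp [h1]
  · rw [h] at hc
    have h1 : cancelMult a b α = 2 := by omega
    rw [h1]
    refine ⟨Dvd.dvd.mul_left (pow_dvd_pow_of_dvd ?_ 2) _, le_rfl⟩
    rw [dvd_iff_isRoot, IsRoot, eval_add, eval_pow, eval_cubicPoly, ← hp, h]
    simp

/-- Numerator and denominator have degree at most `2q + 1` and share a factor of degree `∑ (1 -
χ(D(α))) = q - S`, where `S` is the character sum. This is where the sum enters the height. -/
theorem height_frobNum_div_le (a b : K) {m : ℕ} (hm : 2 * m + 1 = Fintype.card K)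
    (h2 : ringChar K ≠ 2) :
    ((RatFunc.height (algebraMap K[X] (RatFunc K) (frobNum a b m) /
      algebraMap K[X] (RatFunc K) ((X ^ Fintype.card K - X) ^ 2)) : ℕ) : ℤ) ≤
      Fintype.card K + 1 + ∑ x : K, quadraticChar K (x * (x ^ 2 + a * x + b)) := by
  have hdvd : ∏ α : K, (X - C α) ^ cancelMult a b α ∣ frobNum a b m := by
    refine Finset.prod_dvd_of_coprime (fun α _ β _ h ↦ (isCoprime_X_sub_C_of_isUnit_sub
      (sub_ne_zero.mpr h).isUnit).pow) fun α _ ↦ dvd_sub (cancelMult_dvd hm h2 α).1 ?_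
    exact Dvd.dvd.mul_left ((pow_dvd_pow _ (cancelMult_dvd hm h2 α).2).trans
      (pow_dvd_pow_of_dvd (X_sub_C_dvd_X_pow_card_sub_X α) 2)) _
  have hdvd' : ∏ α : K, (X - C α) ^ cancelMult a b α ∣ (X ^ Fintype.card K - X : K[X]) ^ 2 := by
    refine Finset.prod_dvd_of_coprime (fun α _ β _ h ↦ (isCoprime_X_sub_C_of_isUnit_sub
      (sub_ne_zero.mpr h).isUnit).pow) fun α _ ↦ ?_
    exact (pow_dvd_pow _ (cancelMult_dvd hm h2 α).2).trans
      (pow_dvd_pow_of_dvd (X_sub_C_dvd_X_pow_card_sub_X α) 2)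
  have hdeg : (∏ α : K, (X - C α) ^ cancelMult a b α).natDegree = ∑ α : K, cancelMult a b α := by
    rw [natDegree_prod_of_monic _ _ fun α _ ↦ (monic_X_sub_C α).pow _]
    simp
  have hne : ∏ α : K, (X - C α) ^ cancelMult a b α ≠ 0 :=
    (monic_prod_of_monic _ _ fun α _ ↦ (monic_X_sub_C α).pow _).ne_zero
  have hne' : algebraMap K[X] (RatFunc K) (∏ α : K, (X - C α) ^ cancelMult a b α) ≠ 0 :=
    RatFunc.algebraMap_ne_zero hne
  have hsum : ((∑ α : K, cancelMult a b α : ℕ) : ℤ) =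
      Fintype.card K - ∑ x : K, quadraticChar K (x * (x ^ 2 + a * x + b)) := by
    push_cast
    simp [cancelMult_cast]
  have hX0 : (X ^ Fintype.card K - X : K[X]) ^ 2 ≠ 0 :=
    pow_ne_zero 2 (FiniteField.X_pow_card_sub_X_ne_zero K Fintype.one_lt_card)
  have hXd : ((X ^ Fintype.card K - X : K[X]) ^ 2).natDegree ≤ 2 * Fintype.card K := by
    rw [natDegree_pow, FiniteField.X_pow_card_sub_X_natDegree_eq K Fintype.one_lt_card]
  have hNd := natDegree_frobNum_le a b hm
  obtain ⟨f, hf⟩ := hdvd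
  obtain ⟨g, hg⟩ := hdvd'
  rw [hg] at hX0 hXd ⊢
  rw [hf] at hNd ⊢
  have hg0 : g ≠ 0 := right_ne_zero_of_mul hX0
  rw [map_mul, map_mul, mul_div_mul_left _ _ hne']
  have h1 := RatFunc.height_div_le f hg0
  rw [natDegree_mul hne hg0, hdeg] at hXd
  have h3 : f.natDegree + ∑ α : K, cancelMult a b α ≤ 2 * Fintype.card K + 1 := by
    rcases eq_or_ne f 0 with rfl | hf0
    · rw [natDegree_zero, zero_add]
      omega
    · rw [natDegree_mul hne hf0, hdeg] at hNd
      omega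
  omega

/-- Hasse's bound for `y² = x³ + ax² + bx`, by Manin's method. -/
theorem hasse_bound (h2 : (2 : K) ≠ 0) {a b : K} (hb : b ≠ 0)
    (hab : a ^ 2 - 4 * b ≠ 0) (k : ℕ) :
    0 ≤ (Fintype.card K : ℤ) +
      k * ∑ x : K, quadraticChar K (x * (x ^ 2 + a * x + b)) + k ^ 2 := by
  classical
  have hchar : ringChar K ≠ 2 := by
    intro h
    apply h2
    have := ringChar.Nat.cast_ringChar (R := K)
    rw [h] at this
    exact_mod_cast this
  obtain ⟨m, hm⟩ : ∃ m, 2 * m + 1 = Fintype.card K := by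
    have := FiniteField.odd_card_of_char_ne_two hchar
    exact ⟨Fintype.card K / 2, by omega⟩
  set Q := twistPoint h2 hb hab with hQ
  let P : (twistCurve a b).Point :=
    .some _ _ (twistCurve_nonsingular h2 hb hab (twistCurve_equation_frobenius a b hm))
  have hD := algebraMap_cubicPoly_ne_zero a b
  have hP : pointHeight a b P = Fintype.card K := by
    rw [pointHeight_some, mul_div_cancel_left₀ _ hD, RatFunc.height_algebraMap, natDegree_X_pow]
  have hPQ : (pointHeight a b (P - Q) : ℤ) ≤
      Fintype.card K + 1 + ∑ x : K, quadraticChar K (x * (x ^ 2 + a * x + b)) := by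
    refine le_trans (le_of_eq ?_) (height_frobNum_div_le a b hm hchar)
    have hXX : algebraMap K[X] (RatFunc K) (X ^ Fintype.card K) - algebraMap K[X] (RatFunc K) X ≠
        0 := by
      rw [← map_sub]
      exact RatFunc.algebraMap_ne_zero
        (FiniteField.X_pow_card_sub_X_ne_zero K Fintype.one_lt_card)
    have hx : algebraMap K[X] (RatFunc K) (cubicPoly a b) *
        algebraMap K[X] (RatFunc K) (X ^ Fintype.card K) ≠
        algebraMap K[X] (RatFunc K) (cubicPoly a b) * algebraMap K[X] (RatFunc K) X :=
      fun h ↦ hXX (sub_eq_zero.mpr (mul_left_cancel₀ hD h))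
    rw [sub_eq_add_neg, hQ, twistPoint, Point.neg_some, Point.add_of_X_ne hx, pointHeight_some,
      slope_of_X_ne hx]
    congr 2
    simp only [addX, negY, twistCurve, zero_mul, sub_zero, add_zero, frobNum, map_sub, map_mul,
      map_add, map_one, map_pow, sub_neg_eq_add] at hXX ⊢
    generalize algebraMap K[X] (RatFunc K) X = t at *
    generalize algebraMap K[X] (RatFunc K) (cubicPoly a b) = D at *
    rw [← mul_sub]
    field_simp
    ring
  -- The parallelogram inequality at `P - (k+1)Q` bounds second differences of the height by `2`;
  -- the first difference, at `k = 0`, is at most `1 + S`.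
  have hstep : ∀ k : ℕ, (pointHeight a b (P - (k + 1) • Q) : ℤ) ≤ pointHeight a b (P - k • Q) +
      (1 + ∑ x : K, quadraticChar K (x * (x ^ 2 + a * x + b))) + 2 * k := by
    intro k
    induction k with
    | zero =>
      rw [zero_nsmul, sub_zero, zero_add, one_nsmul, hP]
      push_cast
      linarith
    | succ k ih =>
      have h := pointHeight_add_add_pointHeight_sub_le h2 hb hab (P - (k + 1) • Q)
      rw [← hQ, show P - (k + 1) • Q + Q = P - k • Q by rw [succ_nsmul]; abel,
        show P - (k + 1) • Q - Q = P - (k + 1 + 1) • Q by rw [succ_nsmul Q (k + 1)]; abel] at h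
      zify at h
      push_cast
      linarith
  have hall : ∀ k : ℕ, (pointHeight a b (P - k • Q) : ℤ) ≤ Fintype.card K +
      k * ∑ x : K, quadraticChar K (x * (x ^ 2 + a * x + b)) + k ^ 2 := by
    intro k
    induction k with
    | zero => simp [hP]
    | succ k ih =>
      have h := hstep k
      push_cast
      linarith
  exact le_trans (Int.natCast_nonneg _) (hall k)

end Frobenius

/-! ### Quadratic character sums and their transformations -/

section CharSums

variable {K : Type*} [Field K] [Fintype K]

theorem sum_inv (g : K → ℤ) : ∑ x : K, g x⁻¹ = ∑ x : K, g x :=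
  Equiv.sum_comp (inv_involutive.toPerm (fun x : K ↦ x⁻¹)) g

theorem sum_comp_affine {u : K} (hu : u ≠ 0) (v : K) (g : K → ℤ) :
    ∑ x : K, g (u * x + v) = ∑ x : K, g x :=
  Equiv.sum_comp ((Equiv.mulLeft₀ u hu).trans (Equiv.addRight v)) g

variable [DecidableEq K]

theorem sum_comp_sq (h2 : ringChar K ≠ 2) (g : K → ℤ) :
    ∑ x : K, g (x ^ 2) = ∑ b : K, (1 + quadraticChar K b) * g b := by
  rw [← Finset.sum_fiberwise Finset.univ (fun x : K ↦ x ^ 2)]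
  refine Finset.sum_congr rfl fun b _ ↦ ?_
  rw [Finset.sum_congr rfl (g := fun _ ↦ g b) (fun x hx ↦ by rw [(Finset.mem_filter.mp hx).2]),
    Finset.sum_const, nsmul_eq_mul, add_comm, ← quadraticChar_card_sqrts h2]
  congr 3
  ext x
  simp

theorem quadraticChar_mul_sq (a : K) {x : K} (hx : x ≠ 0) :
    quadraticChar K (a * x ^ 2) = quadraticChar K a := by
  rw [map_mul, quadraticChar_sq_one' hx, mul_one]

/-- A sum over the nonzero elements after the substitution `x ↦ 1 / x`. -/
theorem sum_eq_sum_of_inv {f g : K → K} (h0 : f 0 = 0)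
    (h : ∀ x ≠ 0, ∃ y ≠ 0, f x⁻¹ * y ^ 2 = g x) :
    ∑ x : K, quadraticChar K (f x) = ∑ x : K, quadraticChar K (g x) - quadraticChar K (g 0) := by
  rw [← sum_inv fun x ↦ quadraticChar K (f x), ← Finset.add_sum_erase _ _ (Finset.mem_univ 0),
    ← Finset.add_sum_erase (a := 0) _ (fun x ↦ quadraticChar K (g x)) (Finset.mem_univ 0), inv_zero,
    h0, quadraticChar_zero, zero_add, add_sub_cancel_left]
  refine Finset.sum_congr rfl fun x hx ↦ ?_
  obtain ⟨y, hy, e⟩ := h x (Finset.ne_of_mem_erase hx)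
  rw [← e, quadraticChar_mul_sq _ hy]

theorem sum_quadraticChar_affine (h2 : ringChar K ≠ 2) {u : K} (hu : u ≠ 0) (v : K) :
    ∑ x : K, quadraticChar K (u * x + v) = 0 := by
  rw [← quadraticChar_sum_zero (F := K) h2]
  exact Equiv.sum_comp ((Equiv.mulLeft₀ u hu).trans (Equiv.addRight v)) fun x ↦ quadraticChar K x

theorem sum_quadraticChar_sq_add (h2 : ringChar K ≠ 2) {c : K} (hc : c ≠ 0) :
    ∑ x : K, quadraticChar K (x ^ 2 + c) = -1 := by
  rw [sum_comp_sq h2 fun b ↦ quadraticChar K (b + c)]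
  simp only [add_mul, one_mul, Finset.sum_add_distrib, ← map_mul]
  have h1 : ∑ x : K, quadraticChar K (x + c) = 0 := by
    simpa using sum_quadraticChar_affine h2 one_ne_zero c
  rw [h1, sum_eq_sum_of_inv (f := fun x ↦ x * (x + c)) (g := fun x ↦ c * x + 1) (zero_mul _), sum_quadraticChar_affine h2 hc]
  · simp
  · intro x hx
    exact ⟨x, hx, by field_simp; ring⟩

theorem quadraticChar_neg_of_card (hq : Fintype.card K % 4 = 3) (a : K) :
    quadraticChar K (-a) = -quadraticChar K a := by
  have h : quadraticChar K (-1) = -1 := by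
    rw [quadraticChar_neg_one_iff_not_isSquare, FiniteField.isSquare_neg_one_iff]
    simpa using hq
  rw [neg_eq_neg_one_mul, map_mul, h, neg_one_mul]

/-- Squaring permutes the nonzero squares when `-1` is a nonsquare. In the computation, the
correction `∑ χ(x) g(x²)` is odd under `x ↦ -x` and vanishes. -/
theorem sum_comp_pow_four (h2 : ringChar K ≠ 2) (hq : Fintype.card K % 4 = 3) (g : K → ℤ) :
    ∑ x : K, g (x ^ 4) = ∑ x : K, g (x ^ 2) := by
  have e : ∑ x : K, quadraticChar K x * g (x ^ 2) = 0 := by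
    have h := Equiv.sum_comp (Equiv.neg K) fun x ↦ quadraticChar K x * g (x ^ 2)
    simp only [Equiv.neg_apply, quadraticChar_neg_of_card hq, neg_sq, neg_mul,
      Finset.sum_neg_distrib] at h
    linarith
  have h := sum_comp_sq h2 fun b ↦ g (b ^ 2)
  simp only [← pow_mul] at h
  rw [h]
  simp only [add_mul, one_mul, Finset.sum_add_distrib, e, add_zero]

theorem card_roots_quadratic (h2 : ringChar K ≠ 2) (t b : K) :
    ((Finset.univ.filter fun x : K ↦ x ^ 2 - t * x + b = 0).card : ℤ) =
      quadraticChar K (t ^ 2 - 4 * b) + 1 := by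
  have h2' : (2 : K) ≠ 0 := Ring.two_ne_zero h2
  rw [← quadraticChar_card_sqrts h2]
  congr 1
  refine Finset.card_bij' (fun x _ ↦ 2 * x - t) (fun y _ ↦ (y + t) / 2) ?_ ?_ ?_ ?_
  · intro x hx
    simp only [Finset.mem_filter, Finset.mem_univ, true_and, Set.mem_toFinset,
      Set.mem_ofPred_eq] at hx ⊢
    linear_combination 4 * hx
  · intro y hy
    simp only [Finset.mem_filter, Finset.mem_univ, true_and, Set.mem_toFinset,
      Set.mem_ofPred_eq] at hy ⊢
    have h4 : (4 : K) ≠ 0 := by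
      rw [show (4 : K) = 2 * 2 by norm_num]
      exact mul_ne_zero h2' h2'
    apply mul_left_cancel₀ h4
    field_simp
    linear_combination hy
  · intro x _
    field_simp
    ring
  · intro y _
    field_simp
    ring

/-- Curves linked by a 2-isogeny have the same character sum. -/
theorem sum_quadraticChar_isogeny (h2 : ringChar K ≠ 2) (a : K) {b : K} (hb : b ≠ 0) :
    ∑ x : K, quadraticChar K (x * (x ^ 2 + a * x + b)) =
      ∑ x : K, quadraticChar K (x * (x ^ 2 - 2 * a * x + (a ^ 2 - 4 * b))) := by
  -- Dividing by the square `x²` leaves `χ(x + b/x + a)`. The fibre of `x ↦ x + b/x` over `t` is the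
  -- root set of a quadratic of discriminant `t² - 4b`, so it has `1 + χ(t² - 4b)` elements.
  have e₁ : ∑ x : K, quadraticChar K (x * (x ^ 2 + a * x + b)) =
      ∑ x ∈ Finset.univ.erase (0 : K), quadraticChar K (x + b / x + a) := by
    rw [← Finset.add_sum_erase _ _ (Finset.mem_univ 0), zero_mul, quadraticChar_zero, zero_add]
    refine Finset.sum_congr rfl fun x hx ↦ ?_
    have hx := Finset.ne_of_mem_erase hx
    rw [← quadraticChar_mul_sq (x + b / x + a) hx]
    congr 1
    field_simp
    ring
  have e₂ : ∑ x ∈ Finset.univ.erase (0 : K), quadraticChar K (x + b / x + a) =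
      ∑ t : K, (quadraticChar K (t ^ 2 - 4 * b) + 1) * quadraticChar K (t + a) := by
    rw [← Finset.sum_fiberwise _ (fun x : K ↦ x + b / x)]
    refine Finset.sum_congr rfl fun t _ ↦ ?_
    rw [Finset.sum_congr rfl (g := fun _ ↦ quadraticChar K (t + a))
      (fun x hx ↦ by rw [(Finset.mem_filter.mp hx).2]), Finset.sum_const, nsmul_eq_mul,
      ← card_roots_quadratic h2]
    congr 3
    ext x
    simp only [Finset.mem_filter, Finset.mem_erase, Finset.mem_univ, and_true, true_and]
    constructor
    · rintro ⟨hx, rfl⟩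
      field_simp
      ring
    · intro h
      have hx : x ≠ 0 := by
        rintro rfl
        apply hb
        simpa using h
      refine ⟨hx, ?_⟩
      field_simp
      linear_combination h
  have e₃ : ∑ t : K, quadraticChar K (t + a) = 0 := by
    simpa using sum_quadraticChar_affine h2 one_ne_zero a
  rw [e₁, e₂]
  simp only [add_mul, one_mul, Finset.sum_add_distrib, e₃, add_zero, ← map_mul]
  -- The shift `t = x - a` turns `(t² - 4b)(t + a)` into `x((x - a)² - 4b)`.
  rw [← sum_comp_affine one_ne_zero (-a)]
  refine Finset.sum_congr rfl fun x _ ↦ ?_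
  congr 1
  ring

/-! ### The particular sums arising from `∑ αγ` -/

section Specific

variable (h2 : ringChar K ≠ 2) (hq : Fintype.card K % 4 = 3)

include h2 hq

/-- Sophie Germain's identity makes the argument `x⁴ + 4`, and fourth powers may be replaced by
squares. -/
theorem sum_quadraticChar_conj :
    ∑ x : K, quadraticChar K ((x ^ 2 + 2 * x + 2) * (x ^ 2 - 2 * x + 2)) = -1 := by
  have h2' : (2 : K) ≠ 0 := Ring.two_ne_zero h2
  have h4 : (4 : K) ≠ 0 := by
    rw [show (4 : K) = 2 * 2 by norm_num]
    exact mul_ne_zero h2' h2'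
  rw [← sum_quadraticChar_sq_add h2 h4, ← sum_comp_pow_four h2 hq fun b ↦ quadraticChar K (b + 4)]
  refine Finset.sum_congr rfl fun x _ ↦ ?_
  congr 1
  ring

/-- Centring at `-1` makes the argument `(x² + 1)(x² - 1) = x⁴ - 1`. -/
theorem sum_quadraticChar_trivial_quartic :
    ∑ x : K, quadraticChar K ((x ^ 2 + 2 * x + 2) * (x * (x + 2))) = -1 := by
  rw [← sum_quadraticChar_sq_add h2 (neg_ne_zero.mpr one_ne_zero),
    ← sum_comp_pow_four h2 hq fun b ↦ quadraticChar K (b + -1),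
    ← sum_comp_affine one_ne_zero (-1)]
  refine Finset.sum_congr rfl fun x _ ↦ ?_
  congr 1
  ring

omit hq in
theorem sum_quadraticChar_degenerate :
    ∑ x : K, quadraticChar K (x * (x + 2) * (x * (x - 2))) = -1 - quadraticChar K (-4) := by
  have h2' : (2 : K) ≠ 0 := Ring.two_ne_zero h2
  have h4 : (-4 : K) ≠ 0 := by
    rw [show (-4 : K) = -(2 * 2) by norm_num]
    exact neg_ne_zero.mpr (mul_ne_zero h2' h2')
  rw [← sum_quadraticChar_sq_add h2 h4, ← Finset.add_sum_erase _ _ (Finset.mem_univ 0),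
    ← Finset.add_sum_erase (a := 0) _ (fun x ↦ quadraticChar K (x ^ 2 + -4)) (Finset.mem_univ 0)]
  have e : ∑ x ∈ Finset.univ.erase 0, quadraticChar K (x * (x + 2) * (x * (x - 2))) =
      ∑ x ∈ Finset.univ.erase 0, quadraticChar K (x ^ 2 + -4) := by
    refine Finset.sum_congr rfl fun x hx ↦ ?_
    rw [← quadraticChar_mul_sq (x ^ 2 + -4) (Finset.ne_of_mem_erase hx)]
    congr 1
    ring
  rw [e]
  simp

omit hq in
-- The rational root `0` is sent to infinity by `x ↦ 1/x`, leaving a cubic; the substitution `1 -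
-- 2z` gives `χ(2)` times the sum for `x(x² - 4x + 5)`, and its 2-isogenous curve, rescaled by `2`,
-- is `x(x² + 4x - 1)`.
theorem sum_quadraticChar_quartic (h5 : (5 : K) ≠ 0) :
    ∑ x : K, quadraticChar K ((x ^ 2 + 2 * x + 2) * (x * (x - 2))) =
      ∑ x : K, quadraticChar K (x * (x ^ 2 + 4 * x - 1)) - 1 := by
  have h2' : (2 : K) ≠ 0 := Ring.two_ne_zero h2
  rw [sum_eq_sum_of_inv (f := fun x ↦ (x ^ 2 + 2 * x + 2) * (x * (x - 2)))
    (g := fun z ↦ (1 + 2 * z + 2 * z ^ 2) * (1 - 2 * z)) (by simp)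
    fun x hx ↦ ⟨x ^ 2, pow_ne_zero _ hx, by field_simp⟩]
  have e : ∑ z : K, quadraticChar K ((1 + 2 * z + 2 * z ^ 2) * (1 - 2 * z)) =
      quadraticChar K 2 * ∑ x : K, quadraticChar K (x * (x ^ 2 + (-4) * x + 5)) := by
    rw [Finset.mul_sum, ← sum_comp_affine (neg_ne_zero.mpr h2') 1 fun x ↦
      quadraticChar K 2 * quadraticChar K (x * (x ^ 2 + (-4) * x + 5))]
    refine Finset.sum_congr rfl fun x _ ↦ ?_
    rw [← map_mul, ← quadraticChar_mul_sq _ h2']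
    congr 1
    ring
  have e' : quadraticChar K 2 * ∑ x : K, quadraticChar K
      (x * (x ^ 2 - 2 * (-4) * x + ((-4) ^ 2 - 4 * 5))) =
      ∑ x : K, quadraticChar K (x * (x ^ 2 + 4 * x - 1)) := by
    rw [Finset.mul_sum, ← sum_comp_affine h2' 0]
    refine Finset.sum_congr rfl fun x _ ↦ ?_
    rw [← map_mul, ← quadraticChar_mul_sq (x * (x ^ 2 + 4 * x - 1)) (pow_ne_zero 2 h2')]
    congr 1
    ring
  rw [e, sum_quadraticChar_isogeny h2 _ h5, e']
  simp

/-- The argument is a polynomial in `b = x²`, so the sum splits as `∑ (1 + χ(b)) χ((b² + 4) b (b -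
4))`. The untwisted half becomes `x(x² - 2x + 5)` by inversion. The twisted half loses its factor
`b` and is 2-isogenous to `x(x² + 4x - 1)` up to scaling by `-4`, whence the sign. -/
theorem sum_quadraticChar_octic (h5 : (5 : K) ≠ 0) :
    ∑ x : K, quadraticChar K
      ((x ^ 2 + 2 * x + 2) * (x ^ 2 - 2 * x + 2) * (x * (x + 2) * (x * (x - 2)))) =
      ∑ x : K, quadraticChar K (x * (x ^ 2 - 2 * x + 5)) -
      ∑ x : K, quadraticChar K (x * (x ^ 2 + 4 * x - 1)) := by
  have h2' : (2 : K) ≠ 0 := Ring.two_ne_zero h2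
  have h4 : (4 : K) ≠ 0 := by
    rw [show (4 : K) = 2 * 2 by norm_num]
    exact mul_ne_zero h2' h2'
  have h20 : (20 : K) ≠ 0 := by
    rw [show (20 : K) = 4 * 5 by norm_num]
    exact mul_ne_zero h4 h5
  have e₀ : ∑ x : K, quadraticChar K
      ((x ^ 2 + 2 * x + 2) * (x ^ 2 - 2 * x + 2) * (x * (x + 2) * (x * (x - 2)))) =
      ∑ b : K, (1 + quadraticChar K b) * quadraticChar K ((b ^ 2 + 4) * (b * (b - 4))) := by
    rw [← sum_comp_sq h2]
    refine Finset.sum_congr rfl fun x _ ↦ ?_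
    congr 1
    ring
  have e₁ : ∑ b : K, quadraticChar K ((b ^ 2 + 4) * (b * (b - 4))) =
      ∑ x : K, quadraticChar K (x * (x ^ 2 - 2 * x + 5)) - 1 := by
    rw [sum_eq_sum_of_inv (f := fun b ↦ (b ^ 2 + 4) * (b * (b - 4)))
      (g := fun z ↦ (1 + 4 * z ^ 2) * (1 - 4 * z)) (by simp)
      fun x hx ↦ ⟨x ^ 2, pow_ne_zero _ hx, by field_simp⟩,
      ← sum_comp_affine (neg_ne_zero.mpr h4) 1 fun x ↦ quadraticChar K (x * (x ^ 2 - 2 * x + 5))]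
    congr 1
    · refine Finset.sum_congr rfl fun x _ ↦ ?_
      rw [← quadraticChar_mul_sq ((1 + 4 * x ^ 2) * (1 - 4 * x)) h2']
      congr 1
      ring
    · simp
  have e₂ : ∑ b : K, quadraticChar K b * quadraticChar K ((b ^ 2 + 4) * (b * (b - 4))) =
      ∑ b : K, quadraticChar K ((b ^ 2 + 4) * (b - 4)) + 1 := by
    rw [← Finset.add_sum_erase _ _ (Finset.mem_univ 0), ← Finset.add_sum_erase (a := 0) _
      (fun b ↦ quadraticChar K ((b ^ 2 + 4) * (b - 4))) (Finset.mem_univ 0)]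
    have e : ∑ b ∈ Finset.univ.erase 0,
        quadraticChar K b * quadraticChar K ((b ^ 2 + 4) * (b * (b - 4))) =
        ∑ b ∈ Finset.univ.erase 0, quadraticChar K ((b ^ 2 + 4) * (b - 4)) := by
      refine Finset.sum_congr rfl fun x hx ↦ ?_
      rw [← map_mul, ← quadraticChar_mul_sq ((x ^ 2 + 4) * (x - 4)) (Finset.ne_of_mem_erase hx)]
      congr 1
      ring
    have e' : quadraticChar K (((0 : K) ^ 2 + 4) * (0 - 4)) = -1 := by
      rw [show ((0 : K) ^ 2 + 4) * (0 - 4) = -(1 * 4 ^ 2) by ring, quadraticChar_neg_of_card hq,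
        quadraticChar_mul_sq _ h4, map_one]
    rw [e, e', quadraticChar_zero]
    ring
  have e₃ : ∑ b : K, quadraticChar K ((b ^ 2 + 4) * (b - 4)) =
      ∑ x : K, quadraticChar K (x * (x ^ 2 + 8 * x + 20)) := by
    rw [← sum_comp_affine one_ne_zero 4]
    refine Finset.sum_congr rfl fun x _ ↦ ?_
    congr 1
    ring
  have e₄ : ∑ x : K, quadraticChar K (x * (x ^ 2 - 2 * 8 * x + (8 ^ 2 - 4 * 20))) =
      -∑ x : K, quadraticChar K (x * (x ^ 2 + 4 * x - 1)) := by
    rw [← sum_comp_affine (neg_ne_zero.mpr h4) 0, ← Finset.sum_neg_distrib]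
    refine Finset.sum_congr rfl fun x _ ↦ ?_
    rw [← quadraticChar_neg_of_card hq, ← quadraticChar_mul_sq (-(x * (x ^ 2 + 4 * x - 1)))
      (pow_ne_zero 3 h2')]
    congr 1
    ring
  rw [e₀]
  simp only [one_add_mul, Finset.sum_add_distrib]
  rw [e₁, e₂, e₃, sum_quadraticChar_isogeny h2 _ h20, e₄]
  ring

end Specific

end CharSums

/-! ### Solution counts as products of characters -/

section Counting

variable {K : Type*} [Field K] [Fintype K]

theorem sq_add_sq_ne_zero (hq : Fintype.card K % 4 = 3) {x y : K} (hy : y ≠ 0) :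
    x ^ 2 + y ^ 2 ≠ 0 := by
  intro h
  have h1 : IsSquare (-1 : K) := ⟨x / y, by field_simp; linear_combination -h⟩
  rw [FiniteField.isSquare_neg_one_iff] at h1
  exact h1 hq

variable [DecidableEq K]

/-- The number of `x` with `x` and `x + 1` nonzero squares and `1 / x + 1 / (x + 1) = b`. -/
def alphaCount (b : K) : ℕ :=
  (Finset.univ.filter fun x : K ↦ quadraticChar K x = 1 ∧ quadraticChar K (x + 1) = 1 ∧
    b * (x * (x + 1)) = 2 * x + 1).card

/-- The number of solutions `x` for which `x` and `x + 1` have different quadratic characters. -/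
def gammaCount (b : K) : ℕ :=
  (Finset.univ.filter fun x : K ↦ quadraticChar K x * quadraticChar K (x + 1) = -1 ∧
    b * (x * (x + 1)) = -(quadraticChar K (x + 1) : K)).card

theorem exists_sq_of_quadraticChar_ne {a : K} (h : quadraticChar K a ≠ -1) : ∃ m, a = m ^ 2 := by
  by_contra h'
  exact h (quadraticChar_neg_one_iff_not_isSquare.mpr fun ⟨m, hm⟩ ↦ h' ⟨m, by rw [hm, sq]⟩)

theorem powFun_eq (h2 : ringChar K ≠ 2) (hgt : 3 < Fintype.card K) (x : K) :
    powFun K x = (quadraticChar K x : K) * x⁻¹ := by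
  have hodd := FiniteField.odd_card_of_char_ne_two h2
  rcases eq_or_ne x 0 with rfl | hx
  · rw [powFun, zero_pow (by omega), inv_zero, mul_zero]
  · rw [powFun, quadraticChar_eq_pow_of_char_ne_two' h2, eq_mul_inv_iff_mul_eq₀ hx, ← pow_succ]
    congr 1
    omega

theorem sum_indicator_reflect (b : K) (hq : Fintype.card K % 4 = 3) :
    (Finset.univ.filter fun x : K ↦ quadraticChar K x = -1 ∧ quadraticChar K (x + 1) = -1 ∧
      b * (x * (x + 1)) = -(2 * x + 1)).card = alphaCount b := by
  refine Finset.card_bij' (fun x _ ↦ -(x + 1)) (fun x _ ↦ -(x + 1)) ?_ ?_ ?_ ?_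
  · intro x hx
    simp only [Finset.mem_filter, Finset.mem_univ, true_and] at hx ⊢
    obtain ⟨h1, h3, h4⟩ := hx
    rw [show -(x + 1) + 1 = -x by ring, quadraticChar_neg_of_card hq, quadraticChar_neg_of_card hq,
      h1, h3]
    refine ⟨rfl, rfl, ?_⟩
    linear_combination h4
  · intro x hx
    simp only [Finset.mem_filter, Finset.mem_univ, true_and] at hx ⊢
    obtain ⟨h1, h3, h4⟩ := hx
    rw [show -(x + 1) + 1 = -x by ring, quadraticChar_neg_of_card hq, quadraticChar_neg_of_card hq,
      h1, h3]
    refine ⟨rfl, rfl, ?_⟩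
    linear_combination h4
  · intro x _
    ring
  · intro x _
    ring

theorem cDelta_eq (h2 : ringChar K ≠ 2) (hq : Fintype.card K % 4 = 3) (hgt : 3 < Fintype.card K)
    (b : K) : cDelta (powFun K) (-1) 1 b =
      2 * alphaCount b + gammaCount b + if b = 1 then 2 else 0 := by
  -- At `x = 0` and `x = -1` the left side is `F(1) = F(-1) = 1`, as `F(0) = 0`.
  have hz : (Finset.univ.filter fun x : K ↦ (x = 0 ∨ x = -1) ∧ b = 1).card =
      if b = 1 then 2 else 0 := by
    split_ifs with hb
    · rw [show (Finset.univ.filter fun x : K ↦ (x = 0 ∨ x = -1) ∧ b = 1) = {0, -1} by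
        ext x
        simp [hb]]
      exact Finset.card_pair (by simp)
    · simp [hb]
  have key : cDelta (powFun K) (-1) 1 b = alphaCount b +
      (Finset.univ.filter fun x : K ↦ quadraticChar K x = -1 ∧ quadraticChar K (x + 1) = -1 ∧
      b * (x * (x + 1)) = -(2 * x + 1)).card + gammaCount b +
      (Finset.univ.filter fun x : K ↦ (x = 0 ∨ x = -1) ∧ b = 1).card := by
    simp only [cDelta, alphaCount, gammaCount, Finset.card_filter, ← Finset.sum_add_distrib]
    refine Finset.sum_congr rfl fun x _ ↦ ?_
    rw [powFun_eq h2 hgt, powFun_eq h2 hgt]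
    rcases eq_or_ne x 0 with rfl | hx
    · have e : (1 : K) = b ↔ b = 1 := eq_comm
      simp [e]
    rcases eq_or_ne (x + 1) 0 with hx1 | hx1
    · obtain rfl : x = -1 := by linear_combination hx1
      have e : (1 : K) = b ↔ b = 1 := eq_comm
      simp [e, quadraticChar_neg_of_card hq]
    have hx' : x ≠ -1 := fun h ↦ hx1 (by rw [h]; ring)
    have e₁ : (x + 1)⁻¹ + x⁻¹ = b ↔ b * (x * (x + 1)) = 2 * x + 1 := by
      field_simp
      constructor <;> intro h <;> linear_combination -h
    have e₂ : -(x + 1)⁻¹ - x⁻¹ = b ↔ b * (x * (x + 1)) = -1 + -(2 * x) := by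
      field_simp
      constructor <;> intro h <;> linear_combination -h
    have e₃ : (x + 1)⁻¹ - x⁻¹ = b ↔ b * (x * (x + 1)) = -1 := by
      field_simp
      constructor <;> intro h <;> linear_combination -h
    have e₄ : -(x + 1)⁻¹ + x⁻¹ = b ↔ b * (x * (x + 1)) = 1 := by
      field_simp
      constructor <;> intro h <;> linear_combination -h
    rcases quadraticChar_dichotomy hx with h | h <;>
      rcases quadraticChar_dichotomy hx1 with h' | h' <;>
      simp [h, h', hx, hx', e₁, e₂, e₃, e₄]
  rw [key, sum_indicator_reflect b hq, hz]
  ring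

/-- The reflected form of the solutions counted by `alphaCount`. -/
theorem alphaCount_sign {e : K} (he : e = 1 ∨ e = -1) (c : K) :
    alphaCount (e * c) = (Finset.univ.filter fun y : K ↦ quadraticChar K (e * y) = 1 ∧
      quadraticChar K (e * (y - 1)) = 1 ∧ c * y ^ 2 - (c + 2) * y + 1 = 0).card := by
  rcases he with rfl | rfl
  · refine Finset.card_bij' (fun x _ ↦ x + 1) (fun y _ ↦ y - 1) ?_ ?_ ?_ ?_
    · intro x hx
      simp only [Finset.mem_filter, Finset.mem_univ, true_and, one_mul] at hx ⊢
      obtain ⟨h1, h3, h4⟩ := hx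
      rw [add_sub_cancel_right]
      exact ⟨h3, h1, by linear_combination h4⟩
    · intro x hx
      simp only [Finset.mem_filter, Finset.mem_univ, true_and, one_mul] at hx ⊢
      obtain ⟨h1, h3, h4⟩ := hx
      rw [sub_add_cancel]
      exact ⟨h3, h1, by linear_combination h4⟩
    · intro x _
      ring
    · intro x _
      ring
  · refine Finset.card_bij' (fun x _ ↦ -x) (fun y _ ↦ -y) ?_ ?_ ?_ ?_
    · intro x hx
      simp only [Finset.mem_filter, Finset.mem_univ, true_and] at hx ⊢
      obtain ⟨h1, h3, h4⟩ := hx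
      rw [show -1 * -x = x by ring, show -1 * (-x - 1) = x + 1 by ring]
      exact ⟨h1, h3, by linear_combination -h4⟩
    · intro x hx
      simp only [Finset.mem_filter, Finset.mem_univ, true_and] at hx ⊢
      obtain ⟨h1, h3, h4⟩ := hx
      rw [show -x = -1 * x by ring, show -1 * x + 1 = -1 * (x - 1) by ring]
      exact ⟨h1, h3, by linear_combination -h4⟩
    · intro x _
      ring
    · intro x _
      ring

theorem quadraticChar_sign_mul {e : K} (he : e = 1 ∨ e = -1) :
    quadraticChar K e * quadraticChar K e = 1 ∧ e ^ 2 = 1 := by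
  rcases he with rfl | rfl
  · simp
  · rw [← map_mul]
    simp

/-- The two roots of the quadratic satisfy `e(y-1) · e(z-1) · β² = -1`, a nonsquare, so exactly one
passes the second character test. For the first test put `y = ew²`; adding or subtracting `2eβw²` in
the equation gives `e(β² ± 2β + 2)w² = (βw² ± e)²`, so both factors must be squares. Conversely
their square roots recover `w`. -/
theorem alphaCount_formula (h2 : ringChar K ≠ 2) (hq : Fintype.card K % 4 = 3) {e : K}
    (he : e = 1 ∨ e = -1) {β : K} (hβ : β ≠ 0) :
    4 * (alphaCount (e * β ^ 2) : ℤ) = (1 + quadraticChar K (e * (β ^ 2 + 2 * β + 2))) *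
      (1 + quadraticChar K (e * (β ^ 2 - 2 * β + 2))) := by
  have h2' : (2 : K) ≠ 0 := Ring.two_ne_zero h2
  have hee := (quadraticChar_sign_mul he).2
  have he0 : e ≠ 0 := by
    rintro rfl
    simp at hee
  have hP : β ^ 2 + 2 * β + 2 ≠ 0 := by
    rw [show β ^ 2 + 2 * β + 2 = (β + 1) ^ 2 + 1 ^ 2 by ring]
    exact sq_add_sq_ne_zero hq one_ne_zero
  have hM : β ^ 2 - 2 * β + 2 ≠ 0 := by
    rw [show β ^ 2 - 2 * β + 2 = (β - 1) ^ 2 + 1 ^ 2 by ring]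
    exact sq_add_sq_ne_zero hq one_ne_zero
  rw [alphaCount_sign he]
  set S := Finset.univ.filter fun y : K ↦ quadraticChar K (e * y) = 1 ∧
      quadraticChar K (e * (y - 1)) = 1 ∧ β ^ 2 * y ^ 2 - (β ^ 2 + 2) * y + 1 = 0 with hS
  have hmem : ∀ y, y ∈ S ↔ quadraticChar K (e * y) = 1 ∧
      quadraticChar K (e * (y - 1)) = 1 ∧ β ^ 2 * y ^ 2 - (β ^ 2 + 2) * y + 1 = 0 := by
    intro y
    simp [hS]
  have hle : S.card ≤ 1 := by
    rw [Finset.card_le_one]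
    intro y hy z hz
    rw [hmem] at hy hz
    by_contra hyz
    have hsum : β ^ 2 * (y + z) = β ^ 2 + 2 := by
      apply mul_left_cancel₀ (sub_ne_zero.mpr hyz)
      linear_combination hy.2.2 - hz.2.2
    have hprod : e * (y - 1) * (e * (z - 1)) * β ^ 2 = -1 := by
      linear_combination (y - 1) * (z - 1) * β ^ 2 * hee + (y - 1) * hsum - hy.2.2
    have h := congrArg (quadraticChar K) hprod
    rw [quadraticChar_mul_sq _ hβ, map_mul, hy.2.1, hz.2.1, quadraticChar_neg_of_card hq,
      map_one] at h
    norm_num at h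
  have hne : S.Nonempty ↔ quadraticChar K (e * (β ^ 2 + 2 * β + 2)) = 1 ∧
      quadraticChar K (e * (β ^ 2 - 2 * β + 2)) = 1 := by
    constructor
    · rintro ⟨y, hy⟩
      rw [hmem] at hy
      obtain ⟨h1, -, h3⟩ := hy
      obtain ⟨w, hw⟩ := exists_sq_of_quadraticChar_ne (a := e * y) (by rw [h1]; norm_num)
      have hw0 : w ≠ 0 := by
        rintro rfl
        rw [hw] at h1
        simp at h1
      have hyw : y = e * w ^ 2 := by linear_combination e * hw - y * hee
      rw [hyw] at h3
      have hw4 : β ^ 2 * w ^ 4 + 1 = (β ^ 2 + 2) * (e * w ^ 2) := by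
        linear_combination h3 - β ^ 2 * w ^ 4 * hee
      have a₁ : e * (β ^ 2 + 2 * β + 2) * w ^ 2 = (β * w ^ 2 + e) ^ 2 := by
        linear_combination -hw4 - hee
      have a₂ : e * (β ^ 2 - 2 * β + 2) * w ^ 2 = (β * w ^ 2 - e) ^ 2 := by
        linear_combination -hw4 - hee
      rw [← quadraticChar_mul_sq _ hw0, ← quadraticChar_mul_sq (e * (β ^ 2 - 2 * β + 2)) hw0]
      constructor
      · rw [a₁]
        apply quadraticChar_sq_one'
        intro h
        rw [h, zero_pow two_ne_zero] at a₁
        exact mul_ne_zero (mul_ne_zero he0 hP) (pow_ne_zero 2 hw0) a₁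
      · rw [a₂]
        apply quadraticChar_sq_one'
        intro h
        rw [h, zero_pow two_ne_zero] at a₂
        exact mul_ne_zero (mul_ne_zero he0 hM) (pow_ne_zero 2 hw0) a₂
    · rintro ⟨h1, h3⟩
      obtain ⟨m, hm⟩ := exists_sq_of_quadraticChar_ne (a := e * (β ^ 2 + 2 * β + 2))
        (by rw [h1]; norm_num)
      obtain ⟨n, hn⟩ := exists_sq_of_quadraticChar_ne (a := e * (β ^ 2 - 2 * β + 2))
        (by rw [h3]; norm_num)
      -- Solving `mw = βw² + e`, `nw = βw² - e` for `w` gives `(m + n)/(2β)`; the half-difference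
      -- gives the square root belonging to the other root of the quadratic.
      obtain ⟨w, hw⟩ : ∃ w, 2 * β * w = m + n := ⟨(m + n) / (2 * β), by field_simp⟩
      obtain ⟨z, hz⟩ : ∃ z, 2 * β * z = m - n := ⟨(m - n) / (2 * β), by field_simp⟩
      have h4 : (4 : K) ≠ 0 := by
        rw [show (4 : K) = 2 * 2 by norm_num]
        exact mul_ne_zero h2' h2'
      have hwz : β * (w * z) = e := by
        apply mul_left_cancel₀ (mul_ne_zero h4 hβ)
        linear_combination 2 * β * z * hw + (m + n) * hz - hm + hn
      have hsq : β ^ 2 * (w ^ 2 + z ^ 2) = e * (β ^ 2 + 2) := by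
        apply mul_left_cancel₀ h4
        linear_combination (2 * β * w + m + n) * hw + (2 * β * z + m - n) * hz - 2 * hm - 2 * hn
      have hw0 : w ≠ 0 := by
        rintro rfl
        exact he0 (by rw [← hwz]; ring)
      have hz0 : z ≠ 0 := by
        rintro rfl
        exact he0 (by rw [← hwz]; ring)
      have hroot : ∀ u v : K, β * (u * v) = e → β ^ 2 * (u ^ 2 + v ^ 2) = e * (β ^ 2 + 2) →
          β ^ 2 * (e * u ^ 2) ^ 2 - (β ^ 2 + 2) * (e * u ^ 2) + 1 = 0 := by
        intro u v huv hs
        linear_combination β ^ 2 * u ^ 4 * hee + u ^ 2 * hs - (β * u * v + e) * huv - hee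
      have hchar : ∀ u : K, u ≠ 0 → quadraticChar K (e * (e * u ^ 2)) = 1 := by
        intro u hu
        rw [show e * (e * u ^ 2) = (e * u) ^ 2 by ring]
        exact quadraticChar_sq_one' (mul_ne_zero he0 hu)
      have hprod : e * (e * w ^ 2 - 1) * (e * (e * z ^ 2 - 1)) * β ^ 2 = -1 := by
        linear_combination e ^ 4 * (β * w * z + e) * hwz - e ^ 3 * hsq +
          (e ^ 4 - e ^ 2 - 1 - β ^ 2 * e ^ 2) * hee
      have hc := congrArg (quadraticChar K) hprod
      rw [quadraticChar_mul_sq _ hβ, map_mul, quadraticChar_neg_of_card hq, map_one] at hc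
      rcases quadraticChar_isQuadratic K (e * (e * w ^ 2 - 1)) with h | h | h
      · rw [h] at hc
        norm_num at hc
      · exact ⟨e * w ^ 2, (hmem _).mpr ⟨hchar w hw0, h, hroot w z hwz hsq⟩⟩
      · rw [h] at hc
        refine ⟨e * z ^ 2, (hmem _).mpr ⟨hchar z hz0, by linarith, hroot z w ?_ ?_⟩⟩
        · linear_combination hwz
        · linear_combination hsq
  have hP' := quadraticChar_dichotomy (mul_ne_zero he0 hP)
  have hM' := quadraticChar_dichotomy (mul_ne_zero he0 hM)
  by_cases hSn : S.Nonempty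
  · have h1 : S.card = 1 := le_antisymm hle hSn.card_pos
    rw [h1, (hne.mp hSn).1, (hne.mp hSn).2]
    norm_num
  · rw [Finset.not_nonempty_iff_eq_empty.mp hSn, Finset.card_empty]
    rcases hP' with h | h
    · rcases hM' with h' | h'
      · exact absurd (hne.mpr ⟨h, h'⟩) hSn
      · simp [h']
    · simp [h]

/-- Applying `χ` to the equation forces `χ(x+1) = χ(e)`, so the sign on its right-hand side is `e`
itself and the equation becomes one quadratic in `v = -x`. -/
theorem gammaCount_sign (hq : Fintype.card K % 4 = 3) {e : K} (he : e = 1 ∨ e = -1) {β : K}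
    (hβ : β ≠ 0) : gammaCount (e * β ^ 2) = (Finset.univ.filter fun v : K ↦
      quadraticChar K (e * v) = 1 ∧ v ^ 2 - 1 * v + (β ^ 2)⁻¹ = 0).card := by
  have h1 : (1 : K) ≠ -1 := by
    intro h
    exact sq_add_sq_ne_zero hq (x := (1 : K)) one_ne_zero (by linear_combination h)
  have hchar : ∀ x : K, quadraticChar K x * quadraticChar K (x + 1) = -1 →
      e * β ^ 2 * (x * (x + 1)) = -(quadraticChar K (x + 1) : K) →
      (quadraticChar K (x + 1) : K) = e ∧ quadraticChar K (x + 1) = quadraticChar K e := by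
    intro x hx h
    have hh := congrArg (quadraticChar K) h
    rw [show e * β ^ 2 * (x * (x + 1)) = e * (x * (x + 1)) * β ^ 2 by ring,
      quadraticChar_mul_sq _ hβ, map_mul, map_mul, hx, quadraticChar_neg_of_card hq] at hh
    rcases quadraticChar_isQuadratic K (x + 1) with h' | h' | h'
    · rw [h'] at hx
      norm_num at hx
    · rw [h'] at hh ⊢
      rcases he with rfl | rfl
      · simp
      · simp [quadraticChar_neg_of_card hq] at hh
    · rw [h'] at hh ⊢
      rcases he with rfl | rfl
      · simp [quadraticChar_neg_of_card hq] at hh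
      · simp [quadraticChar_neg_of_card hq]
  have hee := (quadraticChar_sign_mul he).2
  have hce := (quadraticChar_sign_mul he).1
  refine Finset.card_bij' (fun x _ ↦ -x) (fun y _ ↦ -y) ?_ ?_ ?_ ?_
  · intro x hx
    simp only [Finset.mem_filter, Finset.mem_univ, true_and] at hx ⊢
    obtain ⟨h3, h4⟩ := hx
    obtain ⟨h5, h6⟩ := hchar x h3 h4
    rw [h5] at h4
    rw [h6] at h3
    constructor
    · rw [mul_neg, quadraticChar_neg_of_card hq, map_mul]
      linarith
    · field_simp
      linear_combination e * h4 - (β ^ 2 * (x * (x + 1)) + 1) * hee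
  · intro v hv
    simp only [Finset.mem_filter, Finset.mem_univ, true_and] at hv ⊢
    obtain ⟨h3, h4⟩ := hv
    have h4' : v * (-v + 1) * β ^ 2 = 1 := by
      field_simp at h4
      linear_combination -h4
    have h5 := congrArg (quadraticChar K) h4'
    rw [quadraticChar_mul_sq _ hβ, map_mul, map_one] at h5
    have h6 : quadraticChar K (-v + 1) = quadraticChar K e := by
      rw [map_mul] at h3
      calc quadraticChar K (-v + 1) =
          (quadraticChar K e * quadraticChar K v) * quadraticChar K (-v + 1) := by rw [h3, one_mul]
        _ = quadraticChar K e * (quadraticChar K v * quadraticChar K (-v + 1)) := by ring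
        _ = _ := by rw [h5, mul_one]
    have h7 : ((quadraticChar K e : ℤ) : K) = e := by
      rcases he with rfl | rfl <;> simp [quadraticChar_neg_of_card hq]
    rw [quadraticChar_neg_of_card hq, neg_mul, h5]
    refine ⟨rfl, ?_⟩
    rw [h6, h7]
    linear_combination (-e) * h4'
  · intro x _
    ring
  · intro x _
    ring

/-- The roots `v` and `1 - v` have a square product, so they pass the character test together, and
`γ` is either `0` or the full root count `1 + χ(β² - 4)`. With `v = es²` the equation reads `eβ(β ±
2)s² = (βs² ± e)²`, which decides between the two. -/
theorem gammaCount_formula (h2 : ringChar K ≠ 2) (hq : Fintype.card K % 4 = 3) {e : K}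
    (he : e = 1 ∨ e = -1) {β : K} (hβ : β ≠ 0) :
    2 * (gammaCount (e * β ^ 2) : ℤ) = (1 + quadraticChar K (e * (β * (β + 2)))) *
      (1 + quadraticChar K (e * (β * (β - 2)))) := by
  have h2' : (2 : K) ≠ 0 := Ring.two_ne_zero h2
  have h4 : (4 : K) ≠ 0 := by
    rw [show (4 : K) = 2 * 2 by norm_num]
    exact mul_ne_zero h2' h2'
  have hee := (quadraticChar_sign_mul he).2
  have hce := (quadraticChar_sign_mul he).1
  have he0 : e ≠ 0 := by
    rintro rfl
    simp at hee
  rw [gammaCount_sign hq he hβ]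
  set S := Finset.univ.filter fun v : K ↦
      quadraticChar K (e * v) = 1 ∧ v ^ 2 - 1 * v + (β ^ 2)⁻¹ = 0 with hS
  have hmem : ∀ v, v ∈ S ↔ quadraticChar K (e * v) = 1 ∧ v ^ 2 - 1 * v + (β ^ 2)⁻¹ = 0 := by
    intro v
    simp [hS]
  have hprod : ∀ v, v ^ 2 - 1 * v + (β ^ 2)⁻¹ = 0 ↔ v * (1 - v) * β ^ 2 = 1 := by
    intro v
    field_simp
    constructor <;> intro h <;> linear_combination -h
  have hne : S.Nonempty ↔ quadraticChar K (e * (β * (β + 2))) ≠ -1 ∧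
      quadraticChar K (e * (β * (β - 2))) ≠ -1 := by
    constructor
    · rintro ⟨v, hv⟩
      obtain ⟨h1, h3⟩ := (hmem v).mp hv
      obtain ⟨s, hs⟩ := exists_sq_of_quadraticChar_ne (a := e * v) (by rw [h1]; norm_num)
      have hs0 : s ≠ 0 := by
        rintro rfl
        rw [hs] at h1
        simp at h1
      rw [hprod] at h3
      have hvs : v = e * s ^ 2 := by linear_combination e * hs - v * hee
      rw [hvs] at h3
      have key : e * s ^ 2 * β ^ 2 = β ^ 2 * s ^ 4 + 1 := by
        linear_combination h3 + β ^ 2 * s ^ 4 * hee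
      have a₁ : e * (β * (β + 2)) * s ^ 2 = (β * s ^ 2 + e) ^ 2 := by
        linear_combination key - hee
      have a₂ : e * (β * (β - 2)) * s ^ 2 = (β * s ^ 2 - e) ^ 2 := by
        linear_combination key - hee
      rw [← quadraticChar_mul_sq _ hs0, ← quadraticChar_mul_sq (e * (β * (β - 2))) hs0, a₁, a₂]
      constructor <;> rw [Ne, quadraticChar_neg_one_iff_not_isSquare, not_not] <;>
        exact IsSquare.sq _
    · rintro ⟨h1, h3⟩
      obtain ⟨m, hm⟩ := exists_sq_of_quadraticChar_ne h1
      obtain ⟨n, hn⟩ := exists_sq_of_quadraticChar_ne h3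
      obtain ⟨s, hs⟩ : ∃ s, 2 * β * s = m + n := ⟨(m + n) / (2 * β), by field_simp⟩
      obtain ⟨t, ht⟩ : ∃ t, 2 * β * t = m - n := ⟨(m - n) / (2 * β), by field_simp⟩
      have hst : β * (s * t) = e := by
        apply mul_left_cancel₀ (mul_ne_zero h4 hβ)
        linear_combination 2 * β * t * hs + (m + n) * ht - hm + hn
      have hsq : s ^ 2 + t ^ 2 = e := by
        apply mul_left_cancel₀ (mul_ne_zero h4 (pow_ne_zero 2 hβ))
        linear_combination (2 * β * s + m + n) * hs + (2 * β * t + m - n) * ht - 2 * hm - 2 * hn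
      have hs0 : s ≠ 0 := by
        rintro rfl
        exact he0 (by rw [← hst]; ring)
      refine ⟨e * s ^ 2, (hmem _).mpr ⟨?_, (hprod _).mpr ?_⟩⟩
      · rw [show e * (e * s ^ 2) = (e * s) ^ 2 by ring]
        exact quadraticChar_sq_one' (mul_ne_zero he0 hs0)
      · linear_combination (β * s * t + e) * hst + hee + (-(β ^ 2 * s ^ 4)) * hee -
          s ^ 2 * β ^ 2 * hsq
  -- If both characters were `0` the claimed product would be `1`, which is odd.
  have hAB : ¬(quadraticChar K (e * (β * (β + 2))) = 0 ∧
      quadraticChar K (e * (β * (β - 2))) = 0) := by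
    rw [quadraticChar_eq_zero_iff, quadraticChar_eq_zero_iff]
    rintro ⟨h, h'⟩
    exact mul_ne_zero (mul_ne_zero he0 hβ) h4 (by linear_combination h - h')
  by_cases hSn : S.Nonempty
  · obtain ⟨h1, h3⟩ := hne.mp hSn
    have hall : S = Finset.univ.filter fun v : K ↦ v ^ 2 - 1 * v + (β ^ 2)⁻¹ = 0 := by
      ext v
      simp only [hmem, Finset.mem_filter, Finset.mem_univ, true_and, and_iff_right_iff_imp]
      intro hv
      obtain ⟨w, hw⟩ := hSn
      obtain ⟨h5, h6⟩ := (hmem w).mp hw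
      by_cases hvw : v = w
      · rw [hvw, h5]
      have hsum : v = 1 - w := by
        apply mul_left_cancel₀ (sub_ne_zero.mpr hvw)
        linear_combination hv - h6
      rw [hprod] at h6
      have h7 := congrArg (quadraticChar K) h6
      rw [quadraticChar_mul_sq _ hβ, map_mul, map_one, ← hsum] at h7
      rw [map_mul] at h5 ⊢
      calc quadraticChar K e * quadraticChar K v =
          (quadraticChar K e * quadraticChar K w) * (quadraticChar K e * quadraticChar K v) := by
            rw [h5, one_mul]
        _ = (quadraticChar K e * quadraticChar K e) *
            (quadraticChar K w * quadraticChar K v) := by ring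
        _ = 1 := by rw [hce, h7, one_mul]
    rw [hall, card_roots_quadratic h2, ← quadraticChar_mul_sq _ hβ,
      show (1 ^ 2 - 4 * (β ^ 2)⁻¹) * β ^ 2 = β ^ 2 - 4 by field_simp]
    have h5 : quadraticChar K (β ^ 2 - 4) = quadraticChar K (e * (β * (β + 2))) *
        quadraticChar K (e * (β * (β - 2))) := by
      rw [← map_mul, ← quadraticChar_mul_sq (β ^ 2 - 4) (mul_ne_zero he0 hβ)]
      congr 1
      ring
    rw [h5]
    rcases quadraticChar_isQuadratic K (e * (β * (β + 2))) with h | h | h <;>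
      rcases quadraticChar_isQuadratic K (e * (β * (β - 2))) with h' | h' | h' <;>
      simp_all
  · rw [Finset.not_nonempty_iff_eq_empty.mp hSn, Finset.card_empty]
    rw [hne] at hSn
    by_cases h1 : quadraticChar K (e * (β * (β + 2))) = -1
    · simp [h1]
    · have h3 : quadraticChar K (e * (β * (β - 2))) = -1 := by
        by_contra h3
        exact hSn ⟨h1, h3⟩
      simp [h3]

end Counting

/-! ### The sum `∑ αγ` and the exceptional points `1` and `4χ(2)` -/

section Spectrum

variable {K : Type*} [Field K] [Fintype K]

theorem five_ne_zero_of_card (hq : Fintype.card K % 4 = 3) : (5 : K) ≠ 0 := by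
  intro h
  exact sq_add_sq_ne_zero hq (x := (2 : K)) one_ne_zero (by linear_combination h)

variable [DecidableEq K]

theorem gammaCount_zero : gammaCount (0 : K) = 0 := by
  rw [gammaCount, Finset.card_eq_zero, Finset.filter_eq_empty_iff]
  rintro x - ⟨h1, h2⟩
  rcases quadraticChar_isQuadratic K (x + 1) with h | h | h <;> simp [h] at h1 h2

theorem alphaCount_zero (hq : Fintype.card K % 4 = 3) : alphaCount (0 : K) = 0 := by
  rw [alphaCount, Finset.card_eq_zero, Finset.filter_eq_empty_iff]
  rintro x - ⟨h1, h2, h3⟩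
  rw [show x + 1 = -x by linear_combination -h3, quadraticChar_neg_of_card hq, h1] at h2
  norm_num at h2

theorem exists_eq_sign_mul_sq (hq : Fintype.card K % 4 = 3) {b : K} (hb : b ≠ 0) :
    ∃ e β : K, (e = 1 ∨ e = -1) ∧ β ≠ 0 ∧ b = e * β ^ 2 := by
  have key : ∀ c : K, c ≠ 0 → quadraticChar K c = 1 → ∃ β, β ≠ 0 ∧ c = β ^ 2 := by
    intro c hc h
    obtain ⟨β, hβ⟩ := exists_sq_of_quadraticChar_ne (a := c) (by rw [h]; norm_num)
    refine ⟨β, ?_, hβ⟩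
    rintro rfl
    exact hc (by rw [hβ]; ring)
  rcases quadraticChar_dichotomy hb with h | h
  · obtain ⟨β, hβ, hc⟩ := key b hb h
    exact ⟨1, β, Or.inl rfl, hβ, by rw [hc, one_mul]⟩
  · obtain ⟨β, hβ, hc⟩ := key (-b) (neg_ne_zero.mpr hb) (by
      rw [quadraticChar_neg_of_card hq, h, neg_neg])
    exact ⟨-1, β, Or.inr rfl, hβ, by linear_combination -hc⟩

theorem sum_sq_add_sum_neg_sq (h2 : ringChar K ≠ 2) (hq : Fintype.card K % 4 = 3) (g : K → ℤ) :
    ∑ x : K, (g (x ^ 2) + g (-x ^ 2)) = 2 * ∑ b : K, g b := by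
  have e : ∑ b : K, (1 + quadraticChar K b) * g (-b) =
      ∑ b : K, (1 - quadraticChar K b) * g b := by
    rw [← Equiv.sum_comp (Equiv.neg K)]
    simp [quadraticChar_neg_of_card hq, sub_eq_add_neg]
  rw [Finset.sum_add_distrib, sum_comp_sq h2, sum_comp_sq h2 fun b ↦ g (-b), e,
    ← Finset.sum_add_distrib, Finset.mul_sum]
  exact Finset.sum_congr rfl fun b _ ↦ by ring

theorem sum_alphaCount_mul_gammaCount (h2 : ringChar K ≠ 2) (hq : Fintype.card K % 4 = 3) :
    8 * ∑ b : K, (alphaCount b : ℤ) * gammaCount b = Fintype.card K + lambdaSum K - 7 := by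
  have h2' : (2 : K) ≠ 0 := Ring.two_ne_zero h2
  have h5 := five_ne_zero_of_card hq
  let P : K → ℤ := fun x ↦ quadraticChar K (x ^ 2 + 2 * x + 2)
  let M : K → ℤ := fun x ↦ quadraticChar K (x ^ 2 - 2 * x + 2)
  let A : K → ℤ := fun x ↦ quadraticChar K (x * (x + 2))
  let B : K → ℤ := fun x ↦ quadraticChar K (x * (x - 2))
  -- `R` collects the products of an even number of the four characters: these survive when `e = 1`
  -- and `e = -1` are added.
  let R : K → ℤ := fun x ↦ 1 + P x * M x + P x * A x + P x * B x + M x * A x + M x * B x +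
    A x * B x + P x * M x * (A x * B x)
  have hR : ∑ x : K, R x = Fintype.card K + lambdaSum K - 5 := by
    have s₁ : ∑ x : K, P x * M x = -1 := by
      rw [← sum_quadraticChar_conj h2 hq]
      simp only [P, M, map_mul]
    have s₂ : ∑ x : K, P x * A x = -1 := by
      rw [← sum_quadraticChar_trivial_quartic h2 hq]
      simp only [P, A, ← map_mul]
    have s₃ : ∑ x : K, P x * B x = ∑ x : K, quadraticChar K (x * (x ^ 2 + 4 * x - 1)) - 1 := by
      rw [← sum_quadraticChar_quartic h2 h5]
      simp only [P, B, ← map_mul]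
    have s₄ : ∑ x : K, M x * A x = ∑ x : K, P x * B x := by
      rw [← Equiv.sum_comp (Equiv.neg K)]
      refine Finset.sum_congr rfl fun x _ ↦ ?_
      simp only [P, M, A, B, ← map_mul, Equiv.neg_apply]
      congr 1
      ring
    have s₅ : ∑ x : K, M x * B x = ∑ x : K, P x * A x := by
      rw [← Equiv.sum_comp (Equiv.neg K)]
      refine Finset.sum_congr rfl fun x _ ↦ ?_
      simp only [P, M, A, B, ← map_mul, Equiv.neg_apply]
      congr 1
      ring
    have s₆ : ∑ x : K, A x * B x = 0 := by
      have h4 : quadraticChar K (-4) = -1 := by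
        rw [show (-4 : K) = -(1 * 2 ^ 2) by norm_num, quadraticChar_neg_of_card hq,
          quadraticChar_mul_sq _ h2', map_one]
      have h := sum_quadraticChar_degenerate h2
      rw [h4] at h
      simp only [A, B, ← map_mul, h]
      norm_num
    have s₇ : ∑ x : K, P x * M x * (A x * B x) =
        ∑ x : K, quadraticChar K (x * (x ^ 2 - 2 * x + 5)) -
        ∑ x : K, quadraticChar K (x * (x ^ 2 + 4 * x - 1)) := by
      rw [← sum_quadraticChar_octic h2 hq h5]
      simp only [P, M, A, B, ← map_mul]
    simp only [R, Finset.sum_add_distrib, s₁, s₂, s₃, s₄, s₅, s₆, s₇, lambdaSum]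
    simp
    ring
  have hpt : ∀ x ∈ Finset.univ.erase (0 : K), 8 * ((alphaCount (x ^ 2) : ℤ) * gammaCount (x ^ 2) +
      (alphaCount (-x ^ 2) : ℤ) * gammaCount (-x ^ 2)) = 2 * R x := by
    intro x hx
    have hx := Finset.ne_of_mem_erase hx
    have a₁ := alphaCount_formula h2 hq (e := 1) (Or.inl rfl) hx
    have a₂ := alphaCount_formula h2 hq (e := -1) (Or.inr rfl) hx
    have g₁ := gammaCount_formula h2 hq (e := 1) (Or.inl rfl) hx
    have g₂ := gammaCount_formula h2 hq (e := -1) (Or.inr rfl) hx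
    simp only [one_mul, neg_one_mul, quadraticChar_neg_of_card hq] at a₁ a₂ g₁ g₂
    have e₁ : 8 * ((alphaCount (x ^ 2) : ℤ) * gammaCount (x ^ 2)) =
        (1 + P x) * (1 + M x) * ((1 + A x) * (1 + B x)) := by
      rw [← a₁, ← g₁]
      ring
    have e₂ : 8 * ((alphaCount (-x ^ 2) : ℤ) * gammaCount (-x ^ 2)) =
        (1 + -P x) * (1 + -M x) * ((1 + -A x) * (1 + -B x)) := by
      rw [← a₂, ← g₂]
      ring
    rw [mul_add, e₁, e₂]
    simp only [R]
    ring
  have hsum := sum_sq_add_sum_neg_sq h2 hq fun b ↦ (alphaCount b : ℤ) * gammaCount b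
  -- The product formulas need `β ≠ 0`. At `0` the product `αγ` vanishes but `R` is `2`, which turns
  -- the constant `-5` into `-7`.
  have hR0 : R 0 = 2 := by
    have h22 : quadraticChar K 2 * quadraticChar K 2 = 1 := by
      rw [← sq, quadraticChar_sq_one h2']
    simp only [R, P, M, A, B, zero_mul, mul_zero, quadraticChar_zero, zero_pow two_ne_zero,
      zero_add, sub_zero, add_zero, h22]
    norm_num
  rw [← Finset.add_sum_erase _ _ (Finset.mem_univ 0)] at hR hsum
  have hsum' := Finset.sum_congr rfl hpt
  rw [← Finset.mul_sum, ← Finset.mul_sum] at hsum'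
  simp only [zero_pow two_ne_zero, neg_zero, gammaCount_zero, Nat.cast_zero, mul_zero,
    add_zero, zero_add] at hsum
  rw [hR0] at hR
  linarith

theorem alphaCount_le_one (h2 : ringChar K ≠ 2) (hq : Fintype.card K % 4 = 3) (b : K) :
    alphaCount b ≤ 1 := by
  rcases eq_or_ne b 0 with rfl | hb
  · rw [alphaCount_zero hq]
    exact zero_le_one
  obtain ⟨e, β, he, hβ, rfl⟩ := exists_eq_sign_mul_sq hq hb
  have h := alphaCount_formula h2 hq he hβ
  rcases quadraticChar_isQuadratic K (e * (β ^ 2 + 2 * β + 2)) with h1 | h1 | h1 <;>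
    rcases quadraticChar_isQuadratic K (e * (β ^ 2 - 2 * β + 2)) with h3 | h3 | h3 <;>
    rw [h1, h3] at h <;> omega

/-- The element `4 χ(2)`. -/
def oddPoint (K : Type*) [Field K] [Fintype K] [DecidableEq K] : K :=
  (quadraticChar K 2 : K) * 2 ^ 2

theorem sign_quadraticChar_two (h2 : ringChar K ≠ 2) :
    (quadraticChar K 2 : K) = 1 ∨ (quadraticChar K 2 : K) = -1 := by
  rcases quadraticChar_dichotomy (Ring.two_ne_zero h2) with h | h <;> simp [h]

theorem quadraticChar_sign_two (h2 : ringChar K ≠ 2) (hq : Fintype.card K % 4 = 3) (a : K) :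
    quadraticChar K ((quadraticChar K 2 : K) * (a * 2)) = quadraticChar K a := by
  rw [map_mul, map_mul]
  rcases quadraticChar_dichotomy (Ring.two_ne_zero h2) with h | h <;>
    simp [h, quadraticChar_neg_of_card hq]

theorem gammaCount_oddPoint (h2 : ringChar K ≠ 2) (hq : Fintype.card K % 4 = 3) :
    gammaCount (oddPoint K) = 1 := by
  have h2' : (2 : K) ≠ 0 := Ring.two_ne_zero h2
  have h := gammaCount_formula h2 hq (sign_quadraticChar_two h2) h2'
  have h4 : quadraticChar K ((2 : K) * 2) = 1 := by
    rw [← sq, quadraticChar_sq_one' h2']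
  rw [show (2 : K) * (2 + 2) = 2 * 2 * 2 by ring, quadraticChar_sign_two h2 hq, h4, sub_self,
    mul_zero, mul_zero, quadraticChar_zero] at h
  rw [oddPoint]
  omega

/-- `γ = 1` requires one character to be `0` and the other `1`. Then `β = ±2` and `8e` is a square,
that is `e = χ(2)` and `b = 4χ(2)`. -/
theorem gammaCount_eq_zero_or_two (h2 : ringChar K ≠ 2) (hq : Fintype.card K % 4 = 3) {b : K}
    (hb : b ≠ oddPoint K) : gammaCount b = 0 ∨ gammaCount b = 2 := by
  have h2' : (2 : K) ≠ 0 := Ring.two_ne_zero h2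
  rcases eq_or_ne b 0 with rfl | hb0
  · exact Or.inl gammaCount_zero
  obtain ⟨e, β, he, hβ, rfl⟩ := exists_eq_sign_mul_sq hq hb0
  have h := gammaCount_formula h2 hq he hβ
  have he0 : e ≠ 0 := by
    rcases he with rfl | rfl <;> simp
  have key : quadraticChar K (e * (2 * 2 ^ 2)) ≠ 1 ∨ e * β ^ 2 ≠ e * 2 ^ 2 := by
    by_contra! h'
    rw [← mul_assoc, quadraticChar_mul_sq _ h2', map_mul] at h'
    apply hb
    rw [h'.2, oddPoint]
    congr 1
    rcases he with rfl | rfl <;>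
      rcases quadraticChar_dichotomy h2' with h3 | h3 <;>
      simp [h3, quadraticChar_neg_of_card hq] at h' ⊢
  have k₁ : quadraticChar K (e * (β * (β + 2))) = 0 →
      quadraticChar K (e * (β * (β - 2))) ≠ 1 := by
    rw [quadraticChar_eq_zero_iff]
    intro h3
    obtain rfl : β = -2 := by
      linear_combination (mul_eq_zero.mp ((mul_eq_zero.mp h3).resolve_left he0)).resolve_left hβ
    rcases key with h' | h'
    · rwa [show e * (-2 * (-2 - 2)) = e * (2 * 2 ^ 2) by ring]
    · exact absurd (by ring) h'
  have k₂ : quadraticChar K (e * (β * (β - 2))) = 0 →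
      quadraticChar K (e * (β * (β + 2))) ≠ 1 := by
    rw [quadraticChar_eq_zero_iff]
    intro h3
    obtain rfl : β = 2 := by
      linear_combination (mul_eq_zero.mp ((mul_eq_zero.mp h3).resolve_left he0)).resolve_left hβ
    rcases key with h' | h'
    · rwa [show e * (2 * (2 + 2)) = e * (2 * 2 ^ 2) by ring]
    · exact absurd rfl h'
  rcases quadraticChar_isQuadratic K (e * (β * (β + 2))) with h1 | h1 | h1 <;>
    rcases quadraticChar_isQuadratic K (e * (β * (β - 2))) with h3 | h3 | h3 <;>
    rw [h1, h3] at h <;> omega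

theorem alphaCount_oddPoint (h2 : ringChar K ≠ 2) (hq : Fintype.card K % 4 = 3) :
    2 * (alphaCount (oddPoint K) : ℤ) = 1 + quadraticChar K 5 := by
  have h2' : (2 : K) ≠ 0 := Ring.two_ne_zero h2
  have h := alphaCount_formula h2 hq (sign_quadraticChar_two h2) h2'
  rw [show (2 : K) ^ 2 + 2 * 2 + 2 = 5 * 2 by norm_num,
    show (2 : K) ^ 2 - 2 * 2 + 2 = 1 * 2 by norm_num, quadraticChar_sign_two h2 hq,
    quadraticChar_sign_two h2 hq, map_one] at h
  rw [oddPoint]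
  linarith

theorem alphaCount_one (h2 : ringChar K ≠ 2) (hq : Fintype.card K % 4 = 3) :
    2 * (alphaCount (1 : K) : ℤ) = 1 + quadraticChar K 5 := by
  have h := alphaCount_formula h2 hq (e := 1) (Or.inl rfl) (one_ne_zero (α := K))
  rw [show (1 : K) * (1 ^ 2 + 2 * 1 + 2) = 5 by norm_num,
    show (1 : K) * (1 ^ 2 - 2 * 1 + 2) = 1 by norm_num, map_one,
    show (1 : K) * 1 ^ 2 = 1 by norm_num] at h
  linarith

theorem gammaCount_one (h2 : ringChar K ≠ 2) (hq : Fintype.card K % 4 = 3) :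
    gammaCount (1 : K) = 0 := by
  have h := gammaCount_formula h2 hq (e := 1) (Or.inl rfl) (one_ne_zero (α := K))
  rw [show (1 : K) * (1 * (1 - 2)) = -1 by norm_num, quadraticChar_neg_of_card hq, map_one,
    show (1 : K) * 1 ^ 2 = 1 by norm_num] at h
  omega

theorem oddPoint_ne_one (h2 : ringChar K ≠ 2) (hq : Fintype.card K % 4 = 3) :
    oddPoint K ≠ 1 := by
  intro h
  have h1 := gammaCount_oddPoint h2 hq
  rw [h, gammaCount_one h2 hq] at h1
  exact zero_ne_one h1

end Spectrum

/-! ### From the counts to the spectrum and the uniformity -/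

section Uniformity

variable {K : Type*} [Field K] [Fintype K]

theorem powFun_mul (x y : K) : powFun K (x * y) = powFun K x * powFun K y :=
  mul_pow _ _ _

variable [DecidableEq K]

theorem cDelta_le_four (h2 : ringChar K ≠ 2) (hq : Fintype.card K % 4 = 3)
    (hgt : 3 < Fintype.card K) (b : K) : cDelta (powFun K) (-1) 1 b ≤ 4 := by
  rw [cDelta_eq h2 hq hgt]
  have ha := alphaCount_le_one h2 hq b
  rcases eq_or_ne b 1 with rfl | hb
  · rw [gammaCount_one h2 hq, if_pos rfl]
    omega
  · rw [if_neg hb]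
    rcases eq_or_ne b (oddPoint K) with rfl | hb'
    · rw [gammaCount_oddPoint h2 hq]
      omega
    · rcases gammaCount_eq_zero_or_two h2 hq hb' with h | h <;> omega

theorem cDelta_eq_of_five_nonsquare (h2 : ringChar K ≠ 2) (hq : Fintype.card K % 4 = 3)
    (hgt : 3 < Fintype.card K) (h5 : quadraticChar K 5 = -1) (b : K) :
    (cDelta (powFun K) (-1) 1 b = 1 ↔ b = oddPoint K) ∧ cDelta (powFun K) (-1) 1 b ≠ 3 ∧
      2 * (if cDelta (powFun K) (-1) 1 b = 4 then 1 else 0) = alphaCount b * gammaCount b := by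
  rw [cDelta_eq h2 hq hgt]
  have ha := alphaCount_le_one h2 hq b
  have h1 := alphaCount_one h2 hq
  have ho := alphaCount_oddPoint h2 hq
  have hne := oddPoint_ne_one h2 hq
  rw [h5] at h1 ho
  rcases eq_or_ne b 1 with rfl | hb
  · have h1' : alphaCount (1 : K) = 0 := by omega
    simp [gammaCount_one h2 hq, h1', hne.symm]
  · rw [if_neg hb]
    rcases eq_or_ne b (oddPoint K) with rfl | hb'
    · have h1' : alphaCount (oddPoint K) = 0 := by omega
      simp [gammaCount_oddPoint h2 hq, h1']
    · have ha' : alphaCount b = 0 ∨ alphaCount b = 1 := by omega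
      rcases gammaCount_eq_zero_or_two h2 hq hb' with h | h <;> rcases ha' with h' | h' <;>
        simp [h, h', hb']

/-- When `5` is a square, `α = 1` at both exceptional points. So `δ(1) = 4` although `αγ = 0` there,
and `δ(4χ(2)) = 3` although `αγ = 1`; the two indicator terms correct for this. -/
theorem cDelta_eq_of_five_square (h2 : ringChar K ≠ 2) (hq : Fintype.card K % 4 = 3)
    (hgt : 3 < Fintype.card K) (h5 : quadraticChar K 5 = 1) (b : K) :
    cDelta (powFun K) (-1) 1 b ≠ 1 ∧ (cDelta (powFun K) (-1) 1 b = 3 ↔ b = oddPoint K) ∧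
      2 * (if cDelta (powFun K) (-1) 1 b = 4 then 1 else 0) + (if b = oddPoint K then 1 else 0) =
        alphaCount b * gammaCount b + if b = 1 then 2 else 0 := by
  rw [cDelta_eq h2 hq hgt]
  have ha := alphaCount_le_one h2 hq b
  have h1 := alphaCount_one h2 hq
  have ho := alphaCount_oddPoint h2 hq
  have hne := oddPoint_ne_one h2 hq
  rw [h5] at h1 ho
  rcases eq_or_ne b 1 with rfl | hb
  · have h1' : alphaCount (1 : K) = 1 := by omega
    simp [gammaCount_one h2 hq, h1', hne.symm]
  · rw [if_neg hb]
    rcases eq_or_ne b (oddPoint K) with rfl | hb'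
    · have h1' : alphaCount (oddPoint K) = 1 := by omega
      simp [gammaCount_oddPoint h2 hq, h1']
    · have ha' : alphaCount b = 0 ∨ alphaCount b = 1 := by omega
      rcases gammaCount_eq_zero_or_two h2 hq hb' with h | h <;> rcases ha' with h' | h' <;>
        simp [h, h', hb']

theorem cOmega_eq_zero {F : K → K} {c : K} {i : ℕ} (h : ∀ b, cDelta F c 1 b ≠ i) :
    cOmega F c i = 0 := by
  rw [cOmega, Finset.card_eq_zero, Finset.filter_eq_empty_iff]
  exact fun b _ ↦ h b

theorem cOmega_eq_one {F : K → K} {c d : K} {i : ℕ} (h : ∀ b, cDelta F c 1 b = i ↔ b = d) :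
    cOmega F c i = 1 := by
  rw [cOmega, Finset.card_eq_one]
  exact ⟨d, by ext b; simp [h]⟩

/-- Both the values `b` and the elements `x`, grouped by the value they produce, number `q`. -/
theorem sum_cOmega {F : K → K} {c : K} (h : ∀ b, cDelta F c 1 b ≤ 4) :
    cOmega F c 0 + cOmega F c 1 + cOmega F c 2 + cOmega F c 3 + cOmega F c 4 = Fintype.card K ∧
    cOmega F c 1 + 2 * cOmega F c 2 + 3 * cOmega F c 3 + 4 * cOmega F c 4 = Fintype.card K := by
  constructor
  · rw [← Finset.card_univ, Finset.card_eq_sum_ones]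
    simp only [cOmega, Finset.card_filter, ← Finset.sum_add_distrib]
    refine Finset.sum_congr rfl fun b _ ↦ ?_
    have := h b
    interval_cases cDelta F c 1 b <;> rfl
  · have e : ∑ b : K, cDelta F c 1 b = Fintype.card K := by
      simp only [cDelta]
      exact (Finset.card_eq_sum_card_fiberwise (s := Finset.univ) (t := Finset.univ)
        (f := fun x : K ↦ F (x + 1) - c * F x) fun x _ ↦ Finset.mem_univ _).symm
    rw [← e]
    simp only [cOmega, Finset.card_filter, Finset.mul_sum, ← Finset.sum_add_distrib]
    refine Finset.sum_congr rfl fun b _ ↦ ?_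
    have := h b
    interval_cases cDelta F c 1 b <;> rfl

theorem cOmega_four_of_five_nonsquare (h2 : ringChar K ≠ 2) (hq : Fintype.card K % 4 = 3)
    (hgt : 3 < Fintype.card K) (h5 : quadraticChar K 5 = -1) :
    16 * (cOmega (powFun K) (-1) 4 : ℤ) = Fintype.card K + lambdaSum K - 7 := by
  have h : 2 * cOmega (powFun K) (-1) 4 = ∑ b : K, alphaCount b * gammaCount b := by
    rw [cOmega, Finset.card_filter, Finset.mul_sum]
    exact Finset.sum_congr rfl fun b _ ↦ (cDelta_eq_of_five_nonsquare h2 hq hgt h5 b).2.2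
  rw [← sum_alphaCount_mul_gammaCount h2 hq]
  zify at h
  linarith

theorem cOmega_four_of_five_square (h2 : ringChar K ≠ 2) (hq : Fintype.card K % 4 = 3)
    (hgt : 3 < Fintype.card K) (h5 : quadraticChar K 5 = 1) :
    16 * (cOmega (powFun K) (-1) 4 : ℤ) = Fintype.card K + lambdaSum K + 1 := by
  have h : 2 * cOmega (powFun K) (-1) 4 + 1 = ∑ b : K, alphaCount b * gammaCount b + 2 := by
    have h := Finset.sum_congr (rfl : (Finset.univ : Finset K) = _)
      fun b _ ↦ (cDelta_eq_of_five_square h2 hq hgt h5 b).2.2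
    rw [Finset.sum_add_distrib, Finset.sum_add_distrib, ← Finset.mul_sum] at h
    rw [cOmega, Finset.card_filter]
    simpa using h
  have h' := sum_alphaCount_mul_gammaCount h2 hq
  zify at h
  linarith

theorem cDelta_powFun_eq {a : K} (ha : a ≠ 0) (c b : K) :
    cDelta (powFun K) c a b = cDelta (powFun K) c 1 (b / powFun K a) := by
  have hF : powFun K a ≠ 0 := pow_ne_zero _ ha
  refine Finset.card_bij' (fun x _ ↦ x / a) (fun x _ ↦ a * x) ?_ ?_ ?_ ?_
  · intro x hx
    simp only [Finset.mem_filter, Finset.mem_univ, true_and] at hx ⊢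
    have e₁ : powFun K x = powFun K a * powFun K (x / a) := by
      rw [← powFun_mul, mul_div_cancel₀ _ ha]
    have e₂ : powFun K (x + a) = powFun K a * powFun K (x / a + 1) := by
      rw [← powFun_mul, mul_add, mul_div_cancel₀ _ ha, mul_one]
    rw [eq_div_iff hF, ← hx, e₁, e₂]
    ring
  · intro x hx
    simp only [Finset.mem_filter, Finset.mem_univ, true_and] at hx ⊢
    rw [eq_div_iff hF] at hx
    rw [← hx, show a * x + a = a * (x + 1) by ring, powFun_mul, powFun_mul]
    ring
  · intro x _
    field_simp
  · intro x _
    field_simp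

theorem cDelta_zero_le (h2 : ringChar K ≠ 2) (hgt : 3 < Fintype.card K) (b : K) :
    cDelta (powFun K) (-1) 0 b ≤ 2 := by
  have h2' : (2 : K) ≠ 0 := Ring.two_ne_zero h2
  -- For `a = 0` the equation is `2χ(x)/x = b`. When `b = 0` its only solution `x = 0` is still in
  -- the set, since `2 / 0 = 0`.
  refine (Finset.card_le_card (t := {2 / b, -2 / b}) fun x hx ↦ ?_).trans Finset.card_le_two
  simp only [Finset.mem_filter, Finset.mem_univ, true_and, Finset.mem_insert,
    Finset.mem_singleton] at hx ⊢
  rw [add_zero, powFun_eq h2 hgt] at hx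
  rcases eq_or_ne x 0 with rfl | hx0
  · left
    have : b = 0 := by rw [← hx]; simp
    simp [this]
  rcases quadraticChar_dichotomy hx0 with h | h
  · left
    have hb : b = 2 * x⁻¹ := by
      rw [← hx, h]
      push_cast
      ring
    rw [hb, eq_div_iff (mul_ne_zero h2' (inv_ne_zero hx0))]
    field_simp
  · right
    have hb : b = -2 * x⁻¹ := by
      rw [← hx, h]
      push_cast
      ring
    rw [hb, eq_div_iff (mul_ne_zero (neg_ne_zero.mpr h2') (inv_ne_zero hx0))]
    field_simp

theorem cDelta_le_cUniformity (h2 : ringChar K ≠ 2) (F : K → K) (b : K) :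
    cDelta F (-1) 1 b ≤ cUniformity F (-1) := by
  have h : (-1 : K) ≠ 1 := Ring.neg_one_ne_one_of_char_ne_two h2
  exact Finset.le_sup (f := fun ab : K × K ↦ cDelta F (-1) ab.1 ab.2) (b := (1, b))
    (by simp)

theorem cUniformity_powFun_le (h2 : ringChar K ≠ 2) (hgt : 3 < Fintype.card K) {k : ℕ}
    (hk : 2 ≤ k) (h : ∀ b : K, cDelta (powFun K) (-1) 1 b ≤ k) :
    cUniformity (powFun K) (-1) ≤ k := by
  refine Finset.sup_le fun ab _ ↦ ?_
  rcases eq_or_ne ab.1 0 with h0 | h0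
  · rw [h0]
    exact (cDelta_zero_le h2 hgt _).trans hk
  · rw [cDelta_powFun_eq h0]
    exact h _

theorem cUniformity_powFun_eq_four (h2 : ringChar K ≠ 2) (hq : Fintype.card K % 4 = 3)
    (hgt : 3 < Fintype.card K) (h : 0 < cOmega (powFun K) (-1) 4) :
    cUniformity (powFun K) (-1) = 4 := by
  refine le_antisymm (cUniformity_powFun_le h2 hgt (by norm_num) (cDelta_le_four h2 hq hgt)) ?_
  obtain ⟨b, hb⟩ := Finset.card_pos.mp h
  rw [← (Finset.mem_filter.mp hb).2]
  exact cDelta_le_cUniformity h2 _ b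

theorem cUniformity_powFun_eq_two (h2 : ringChar K ≠ 2) (hq : Fintype.card K % 4 = 3)
    (hgt : 3 < Fintype.card K) (h5 : quadraticChar K 5 = -1)
    (h : cOmega (powFun K) (-1) 4 = 0) : cUniformity (powFun K) (-1) = 2 := by
  refine le_antisymm (cUniformity_powFun_le h2 hgt le_rfl fun b ↦ ?_) ?_
  · have h3 := (cDelta_eq_of_five_nonsquare h2 hq hgt h5 b).2.1
    have h4 := cDelta_le_four h2 hq hgt b
    rw [cOmega, Finset.card_eq_zero, Finset.filter_eq_empty_iff] at h
    have := h (Finset.mem_univ b)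
    omega
  · refine le_trans (le_of_eq ?_) (cDelta_le_cUniformity h2 _ 1)
    have h1 := alphaCount_one h2 hq
    rw [cDelta_eq h2 hq hgt, gammaCount_one h2 hq, if_pos rfl]
    omega

/-- The range in the definition stops at the uniformity, which may be less than `4`; the entries
added here are zero and are filtered out. -/
theorem cSpectrum_powFun (h2 : ringChar K ≠ 2) (hq : Fintype.card K % 4 = 3)
    (hgt : 3 < Fintype.card K) :
    (cSpectrum (powFun K) (-1)).map (fun w : ℕ ↦ (w : ℚ)) =
      ({(cOmega (powFun K) (-1) 0 : ℚ), (cOmega (powFun K) (-1) 1 : ℚ),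
        (cOmega (powFun K) (-1) 2 : ℚ), (cOmega (powFun K) (-1) 3 : ℚ),
        (cOmega (powFun K) (-1) 4 : ℚ)} : Multiset ℚ).filter (fun w ↦ 0 < w) := by
  have hle := cUniformity_powFun_le h2 hgt (by norm_num) (cDelta_le_four h2 hq hgt)
  have key : cSpectrum (powFun K) (-1) =
      ((Multiset.range 5).map (cOmega (powFun K) (-1))).filter fun w ↦ 0 < w := by
    obtain ⟨d, hd⟩ : ∃ d, 5 = cUniformity (powFun K) (-1) + 1 + d :=
      ⟨4 - cUniformity (powFun K) (-1), by omega⟩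
    rw [hd, Multiset.range_add, Multiset.map_add, Multiset.filter_add, cSpectrum]
    refine (add_eq_left.mpr ?_).symm
    rw [Multiset.filter_eq_nil]
    intro w hw
    obtain ⟨j, hj, rfl⟩ := Multiset.mem_map.mp hw
    obtain ⟨i, -, rfl⟩ := Multiset.mem_map.mp hj
    rw [cOmega_eq_zero fun b ↦ ?_]
    · exact lt_irrefl 0
    · have := cDelta_le_cUniformity h2 (powFun K) b
      omega
  rw [key, show Multiset.range 5 = {0, 1, 2, 3, 4} from rfl]
  have e : (fun w : ℕ ↦ 0 < w) = (fun w : ℚ ↦ 0 < w) ∘ fun w : ℕ ↦ (w : ℚ) := by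
    ext w
    simp
  simp only [e]
  rw [← Multiset.filter_map, Multiset.map_map]
  rfl

end Uniformity

/-! ### Positivity of `q + λ - 7` and the fields of 7 and 27 elements -/

section SmallFields

theorem quadraticChar_ringEquiv {F K : Type*} [Field F] [Fintype F] [DecidableEq F] [Field K]
    [Fintype K] [DecidableEq K] (e : F ≃+* K) (x : F) :
    quadraticChar K (e x) = quadraticChar F x := by
  have h : IsSquare (e x) ↔ IsSquare x :=
    ⟨fun h ↦ by simpa using h.map e.symm, fun h ↦ h.map e⟩
  simp [quadraticChar_apply, quadraticCharFun, h]

theorem lambdaSum_ringEquiv {F K : Type*} [Field F] [Fintype F] [DecidableEq F] [Field K]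
    [Fintype K] [DecidableEq K] (e : F ≃+* K) : lambdaSum K = lambdaSum F := by
  rw [lambdaSum, lambdaSum, ← Equiv.sum_comp e.toEquiv, ← Equiv.sum_comp e.toEquiv]
  congr 1 <;> refine Finset.sum_congr rfl fun x _ ↦ ?_ <;>
    rw [← quadraticChar_ringEquiv e] <;> congr 1 <;>
    simp only [map_mul, map_add, map_sub, map_pow, map_one, map_ofNat] <;> rfl

variable {K : Type*} [Field K] [Fintype K] [DecidableEq K]

theorem lambdaSum_eq_zmod {p : ℕ} [Fact p.Prime] (hK : Fintype.card K = p) :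
    lambdaSum K = lambdaSum (ZMod p) :=
  lambdaSum_ringEquiv (ZMod.ringEquivOfPrime K (Fact.out : p.Prime) hK)

instance : Fact (Nat.Prime 7) := ⟨by norm_num⟩

instance : Fact (Nat.Prime 11) := ⟨by norm_num⟩

instance : Fact (Nat.Prime 19) := ⟨by norm_num⟩

instance : Fact (Nat.Prime 23) := ⟨by norm_num⟩

theorem lambdaSum_of_card_seven (hK : Fintype.card K = 7) : lambdaSum K = 0 := by
  rw [lambdaSum_eq_zmod hK]
  decide +kernel

theorem lambdaSum_pos_of_card_eleven (hK : Fintype.card K = 11) : 0 < lambdaSum K + 4 := by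
  rw [lambdaSum_eq_zmod hK]
  decide +kernel

theorem lambdaSum_pos_of_card_nineteen (hK : Fintype.card K = 19) : 0 < lambdaSum K + 12 := by
  rw [lambdaSum_eq_zmod hK]
  decide +kernel

theorem lambdaSum_pos_of_card_twentythree (hK : Fintype.card K = 23) :
    0 < lambdaSum K + 16 := by
  rw [lambdaSum_eq_zmod hK]
  decide +kernel

/-- In a field with 27 elements, a set stable under cubing has as many elements, modulo 3, as it
has in the prime field. -/
theorem card_filter_modEq_three (hK : Fintype.card K = 27) {P : K → Prop} [DecidablePred P]
    (hP : ∀ x, P x → P (x ^ 3)) :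
    (Finset.univ.filter P).card ≡ (Finset.univ.filter fun x ↦ P x ∧ x ^ 3 = x).card [MOD 3] := by
  let f : Function.End {x : K // P x} := fun x ↦ ⟨x.1 ^ 3, hP _ x.2⟩
  -- Cubing is the Frobenius, of order dividing 3 on 27 elements, so its orbits have length 1 or 3.
  have hf : f ^ 3 ^ 1 = 1 := by
    funext x
    apply Subtype.ext
    change ((x.1 ^ 3) ^ 3) ^ 3 = x.1
    have h := FiniteField.pow_card x.1
    rw [hK] at h
    rw [← pow_mul, ← pow_mul]
    exact h
  classical
  have h := Equiv.Perm.card_fixedPoints_modEq hf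
  have e₁ : Fintype.card {x : K // P x} = (Finset.univ.filter P).card := Fintype.card_subtype P
  have e₂ : Fintype.card (Function.fixedPoints f) =
      (Finset.univ.filter fun x ↦ P x ∧ x ^ 3 = x).card := by
    rw [← Fintype.card_subtype]
    refine Fintype.card_congr ⟨fun x ↦ ⟨x.1.1, x.1.2, congrArg Subtype.val x.2⟩,
      fun x ↦ ⟨⟨x.1, x.2.1⟩, Subtype.ext x.2.2⟩, fun _ ↦ rfl, fun _ ↦ rfl⟩
  rwa [e₁, e₂] at h

theorem sum_quadraticChar_eq_card_sub_card (g : K → K) : ∑ x : K, quadraticChar K (g x) =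
    ((Finset.univ.filter fun x ↦ quadraticChar K (g x) = 1).card : ℤ) -
      (Finset.univ.filter fun x ↦ quadraticChar K (g x) = -1).card := by
  rw [Finset.card_filter, Finset.card_filter]
  push_cast
  rw [← Finset.sum_sub_distrib]
  refine Finset.sum_congr rfl fun x _ ↦ ?_
  rcases quadraticChar_isQuadratic K (g x) with h | h | h <;> simp [h]

/-- In characteristic 3 both cubics become `x(x² + x - 1)`, so `λ = 2S`. Three constraints determine
`S`: Hasse's bound, a congruence modulo 3 from Frobenius orbits, and one modulo 8 from the assumed
divisibility, which expresses the integrality of `ω₄`. -/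
theorem lambdaSum_of_card_twentyseven (hK : Fintype.card K = 27)
    (h16 : quadraticChar K 5 = -1 → (16 : ℤ) ∣ 20 + lambdaSum K) : lambdaSum K = -20 := by
  have hq : Fintype.card K % 4 = 3 := by rw [hK]
  have h3 : (3 : K) = 0 := by
    have h := Nat.cast_card_eq_zero K
    rw [hK, show 27 = 3 ^ 3 by norm_num] at h
    rw [Nat.cast_pow, Nat.cast_ofNat] at h
    exact (pow_eq_zero_iff three_ne_zero).mp h
  have h2 : (2 : K) ≠ 0 := by
    rw [show (2 : K) = -1 by linear_combination h3]
    exact neg_ne_zero.mpr one_ne_zero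
  have h12 : (1 : K) ≠ -1 := by
    intro h
    exact h2 (by linear_combination h)
  set S := ∑ x : K, quadraticChar K (x * (x ^ 2 + 1 * x + -1)) with hS
  have hl : lambdaSum K = S + S := by
    rw [lambdaSum]
    congr 1 <;> refine Finset.sum_congr rfl fun x _ ↦ ?_ <;> congr 1
    · linear_combination x ^ 2 * h3
    · linear_combination (-x ^ 2 + 2 * x) * h3
  -- The twist `x ↦ -x` reverses the sign of the sum, so `k = 5` for both curves gives `|S| ≤ 10`.
  have hpos := hasse_bound (K := K) h2 (a := 1) (b := -1) (by simp)
    (by rw [show (1 : K) ^ 2 - 4 * (-1) = 2 by linear_combination h3]; exact h2) 5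
  have hneg := hasse_bound (K := K) h2 (a := -1) (b := -1) (by simp)
    (by rw [show (-1 : K) ^ 2 - 4 * (-1) = 2 by linear_combination h3]; exact h2) 5
  have htw : ∑ x : K, quadraticChar K (x * (x ^ 2 + -1 * x + -1)) = -S := by
    rw [hS, ← Equiv.sum_comp (Equiv.neg K), ← Finset.sum_neg_distrib]
    refine Finset.sum_congr rfl fun x _ ↦ ?_
    rw [← quadraticChar_neg_of_card hq]
    congr 1
    simp only [Equiv.neg_apply]
    ring
  rw [htw, hK] at hneg
  rw [← hS, hK] at hpos
  push_cast at hpos hneg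
  have hcube : ∀ x : K, quadraticChar K (x ^ 3 * ((x ^ 3) ^ 2 + 1 * x ^ 3 + -1)) =
      quadraticChar K (x * (x ^ 2 + 1 * x + -1)) := by
    intro x
    rw [show x ^ 3 * ((x ^ 3) ^ 2 + 1 * x ^ 3 + -1) = (x * (x ^ 2 + 1 * x + -1)) ^ 3 by
      linear_combination (-x ^ 3 * ((x ^ 2 + x) * (x - 1) * (x ^ 2 - 1))) * h3, map_pow]
    rcases quadraticChar_isQuadratic K (x * (x ^ 2 + 1 * x + -1)) with h | h | h <;> rw [h] <;>
      norm_num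
  have hfix : ∀ x : K, x ^ 3 = x → x = 0 ∨ x = 1 ∨ x = -1 := by
    intro x hx
    have h : x * ((x - 1) * (x + 1)) = 0 := by linear_combination hx
    rcases mul_eq_zero.mp h with h | h
    · exact Or.inl h
    · rcases mul_eq_zero.mp h with h | h
      · exact Or.inr (Or.inl (by linear_combination h))
      · exact Or.inr (Or.inr (by linear_combination h))
  have v₁ : quadraticChar K ((1 : K) * (1 ^ 2 + 1 * 1 + -1)) = 1 := by norm_num
  have v₂ : quadraticChar K ((-1 : K) * ((-1) ^ 2 + 1 * (-1) + -1)) = 1 := by norm_num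
  have c₁ := card_filter_modEq_three hK
    (P := fun x ↦ quadraticChar K (x * (x ^ 2 + 1 * x + -1)) = 1)
    fun x hx ↦ (hcube x).trans hx
  have c₂ := card_filter_modEq_three hK
    (P := fun x ↦ quadraticChar K (x * (x ^ 2 + 1 * x + -1)) = -1)
    fun x hx ↦ (hcube x).trans hx
  have d₁ : (Finset.univ.filter fun x : K ↦ quadraticChar K (x * (x ^ 2 + 1 * x + -1)) = 1 ∧
      x ^ 3 = x).card = 2 := by
    rw [show (Finset.univ.filter fun x : K ↦ quadraticChar K (x * (x ^ 2 + 1 * x + -1)) = 1 ∧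
      x ^ 3 = x) = {1, -1} by
        ext x
        simp only [Finset.mem_filter, Finset.mem_univ, true_and, Finset.mem_insert,
          Finset.mem_singleton]
        constructor
        · rintro ⟨h, h'⟩
          rcases hfix x h' with rfl | h'
          · simp at h
          · exact h'
        · rintro (rfl | rfl)
          · exact ⟨v₁, by norm_num⟩
          · exact ⟨v₂, by norm_num⟩]
    exact Finset.card_pair h12
  have d₂ : (Finset.univ.filter fun x : K ↦ quadraticChar K (x * (x ^ 2 + 1 * x + -1)) = -1 ∧
      x ^ 3 = x).card = 0 := by
    rw [Finset.card_eq_zero, Finset.filter_eq_empty_iff]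
    rintro x - ⟨h, h'⟩
    rcases hfix x h' with rfl | rfl | rfl
    · simp at h
    · rw [v₁] at h
      norm_num at h
    · rw [v₂] at h
      norm_num at h
  have hSc := sum_quadraticChar_eq_card_sub_card (K := K) fun x ↦ x * (x ^ 2 + 1 * x + -1)
  rw [← hS] at hSc
  rw [d₁] at c₁
  rw [d₂] at c₂
  unfold Nat.ModEq at c₁ c₂
  have h5 : quadraticChar K 5 = -1 := by
    rw [show (5 : K) = -1 by linear_combination 2 * h3, quadraticChar_neg_of_card hq, map_one]
  -- Now `S ≡ 2` modulo 3, `S ≡ 6` modulo 8 and `|S| ≤ 10`, which leaves only `S = -10`.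
  have h16 := h16 h5
  rw [hl] at h16 ⊢
  omega

theorem lambdaSum_bound (hq : Fintype.card K % 4 = 3) (h2 : (2 : K) ≠ 0) (k : ℕ) :
    0 ≤ 2 * (Fintype.card K : ℤ) + k * lambdaSum K + 2 * k ^ 2 := by
  have h5 := five_ne_zero_of_card hq
  have h₁ := hasse_bound h2 (a := 4) (b := -1) (by simp) (by
    rw [show (4 : K) ^ 2 - 4 * -1 = 2 * 2 * 5 by norm_num]
    exact mul_ne_zero (mul_ne_zero h2 h2) h5) k
  have h₃ := hasse_bound h2 (a := -2) (b := 5) h5 (by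
    rw [show (-2 : K) ^ 2 - 4 * 5 = -(2 * 2 * 2 * 2) by norm_num]
    exact neg_ne_zero.mpr (mul_ne_zero (mul_ne_zero (mul_ne_zero h2 h2) h2) h2)) k
  have e₁ : ∑ x : K, quadraticChar K (x * (x ^ 2 + 4 * x + -1)) =
      ∑ x : K, quadraticChar K (x * (x ^ 2 + 4 * x - 1)) :=
    Finset.sum_congr rfl fun x _ ↦ by congr 1; ring
  have e₂ : ∑ x : K, quadraticChar K (x * (x ^ 2 + -2 * x + 5)) =
      ∑ x : K, quadraticChar K (x * (x ^ 2 - 2 * x + 5)) :=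
    Finset.sum_congr rfl fun x _ ↦ by congr 1; ring
  rw [e₁] at h₁
  rw [e₂] at h₃
  rw [lambdaSum]
  linarith

theorem card_add_lambdaSum_pos (hq : Fintype.card K % 4 = 3) (hgt : 3 < Fintype.card K)
    (h2 : (2 : K) ≠ 0) (h7 : Fintype.card K ≠ 7) (h27 : Fintype.card K ≠ 27) :
    0 < (Fintype.card K : ℤ) + lambdaSum K - 7 := by
  -- With `k = 5` this gives `5(q + λ - 7) ≥ 3q - 85`, positive from `q = 29` on. The remaining `q ≡
  -- 3` modulo 4 are `11`, `15`, `19` and `23`, and `15` is not a prime power.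
  have hb := lambdaSum_bound hq h2 5
  have h15 : Fintype.card K ≠ 15 := by
    intro h
    have hpp := FiniteField.isPrimePow_card K
    rw [h] at hpp
    exact absurd hpp (by decide +kernel)
  by_cases h11 : Fintype.card K = 11
  · have := lambdaSum_pos_of_card_eleven h11
    omega
  by_cases h19 : Fintype.card K = 19
  · have := lambdaSum_pos_of_card_nineteen h19
    omega
  by_cases h23 : Fintype.card K = 23
  · have := lambdaSum_pos_of_card_twentythree h23
    omega
  push_cast at hb
  omega

end SmallFields

/-! ### Assembly -/

theorem mainTheorem2 {K : Type*} [Field K] [Fintype K] [DecidableEq K] (p n : ℕ)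
    (hp : p.Prime) (hK : Fintype.card K = p ^ n) (hmod : p ^ n % 4 = 3) (hgt : 3 < p ^ n) :
    (quadraticChar K 5 = -1 ∨ quadraticChar K 5 = 1) ∧
    (quadraticChar K 5 = -1 →
      ((cOmega (powFun K) (-1) 0 : ℚ) = (9 * (p : ℚ) ^ n + lambdaSum K - 15) / 16 ∧
        cOmega (powFun K) (-1) 1 = 1 ∧
        (cOmega (powFun K) (-1) 2 : ℚ) = (3 * (p : ℚ) ^ n - lambdaSum K + 3) / 8 ∧
        (cOmega (powFun K) (-1) 4 : ℚ) = ((p : ℚ) ^ n + lambdaSum K - 7) / 16 ∧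
        ∀ i : ℕ, i ∉ ({0, 1, 2, 4} : Set ℕ) → cOmega (powFun K) (-1) i = 0) ∧
      (cSpectrum (powFun K) (-1)).map (fun w : ℕ => (w : ℚ)) =
        ({(9 * (p : ℚ) ^ n + lambdaSum K - 15) / 16, 1,
          (3 * (p : ℚ) ^ n - lambdaSum K + 3) / 8,
          ((p : ℚ) ^ n + lambdaSum K - 7) / 16} : Multiset ℚ).filter (fun w => 0 < w)) ∧
    (quadraticChar K 5 = 1 →
      ((cOmega (powFun K) (-1) 0 : ℚ) = (9 * (p : ℚ) ^ n + lambdaSum K + 9) / 16 ∧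
        (cOmega (powFun K) (-1) 2 : ℚ) = (3 * (p : ℚ) ^ n - lambdaSum K - 13) / 8 ∧
        cOmega (powFun K) (-1) 3 = 1 ∧
        (cOmega (powFun K) (-1) 4 : ℚ) = ((p : ℚ) ^ n + lambdaSum K + 1) / 16 ∧
        ∀ i : ℕ, i ∉ ({0, 2, 3, 4} : Set ℕ) → cOmega (powFun K) (-1) i = 0) ∧
      (cSpectrum (powFun K) (-1)).map (fun w : ℕ => (w : ℚ)) =
        ({(9 * (p : ℚ) ^ n + lambdaSum K + 9) / 16,
          (3 * (p : ℚ) ^ n - lambdaSum K - 13) / 8, 1,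
          ((p : ℚ) ^ n + lambdaSum K + 1) / 16} : Multiset ℚ).filter (fun w => 0 < w)) ∧
    (p ^ n ≠ 7 → p ^ n ≠ 27 → cUniformity (powFun K) (-1) = 4) ∧
    (p ^ n = 7 ∨ p ^ n = 27 → IsAPcN (powFun K) (-1)) := by
  have hq : Fintype.card K % 4 = 3 := by rw [hK, hmod]
  have hgt' : 3 < Fintype.card K := by rw [hK]; exact hgt
  have h2 : ringChar K ≠ 2 := by
    intro h
    have := FiniteField.even_card_of_char_two h
    omega
  have hcast : (p : ℚ) ^ n = (Fintype.card K : ℚ) := by rw [hK]; push_cast; rfl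
  have h5 := quadraticChar_dichotomy (five_ne_zero_of_card hq)
  have hle := cDelta_le_four h2 hq hgt'
  have hbig : ∀ i, 4 < i → cOmega (powFun K) (-1) i = 0 := fun i hi ↦
    cOmega_eq_zero fun b h ↦ by
      have := hle b
      omega
  obtain ⟨s₁, s₂⟩ := sum_cOmega hle
  have hspec := cSpectrum_powFun h2 hq hgt'
  rw [hcast, ← hK]
  refine ⟨h5.symm, fun h ↦ ?_, fun h ↦ ?_, fun h7 h27 ↦ ?_, fun hor ↦ ?_⟩
  · have w₁ : cOmega (powFun K) (-1) 1 = 1 :=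
      cOmega_eq_one fun b ↦ (cDelta_eq_of_five_nonsquare h2 hq hgt' h b).1
    have w₃ : cOmega (powFun K) (-1) 3 = 0 :=
      cOmega_eq_zero fun b ↦ (cDelta_eq_of_five_nonsquare h2 hq hgt' h b).2.1
    have w₄ := cOmega_four_of_five_nonsquare h2 hq hgt' h
    have r₄ : (cOmega (powFun K) (-1) 4 : ℚ) = ((Fintype.card K : ℚ) + lambdaSum K - 7) / 16 := by
      have := congrArg (Int.cast : ℤ → ℚ) w₄
      push_cast at this
      linarith
    rw [w₁, w₃] at s₁ s₂
    have t₁ := congrArg (Nat.cast : ℕ → ℚ) s₁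
    have t₂ := congrArg (Nat.cast : ℕ → ℚ) s₂
    push_cast at t₁ t₂
    have r₂ : (cOmega (powFun K) (-1) 2 : ℚ) =
        (3 * (Fintype.card K : ℚ) - lambdaSum K + 3) / 8 := by linarith
    have r₀ : (cOmega (powFun K) (-1) 0 : ℚ) =
        (9 * (Fintype.card K : ℚ) + lambdaSum K - 15) / 16 := by linarith
    refine ⟨⟨r₀, w₁, r₂, r₄, fun i hi ↦ ?_⟩, ?_⟩
    · rcases le_or_gt i 4 with h4 | h4
      · interval_cases i <;> simp_all
      · exact hbig i h4
    · rw [hspec, r₀, w₁, r₂, w₃, r₄]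
      simp [Multiset.filter_cons, Multiset.filter_singleton]
  · have w₁ : cOmega (powFun K) (-1) 1 = 0 :=
      cOmega_eq_zero fun b ↦ (cDelta_eq_of_five_square h2 hq hgt' h b).1
    have w₃ : cOmega (powFun K) (-1) 3 = 1 :=
      cOmega_eq_one fun b ↦ (cDelta_eq_of_five_square h2 hq hgt' h b).2.1
    have w₄ := cOmega_four_of_five_square h2 hq hgt' h
    have r₄ : (cOmega (powFun K) (-1) 4 : ℚ) = ((Fintype.card K : ℚ) + lambdaSum K + 1) / 16 := by
      have := congrArg (Int.cast : ℤ → ℚ) w₄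
      push_cast at this
      linarith
    rw [w₁, w₃] at s₁ s₂
    have t₁ := congrArg (Nat.cast : ℕ → ℚ) s₁
    have t₂ := congrArg (Nat.cast : ℕ → ℚ) s₂
    push_cast at t₁ t₂
    have r₂ : (cOmega (powFun K) (-1) 2 : ℚ) =
        (3 * (Fintype.card K : ℚ) - lambdaSum K - 13) / 8 := by linarith
    have r₀ : (cOmega (powFun K) (-1) 0 : ℚ) =
        (9 * (Fintype.card K : ℚ) + lambdaSum K + 9) / 16 := by linarith
    refine ⟨⟨r₀, r₂, w₃, r₄, fun i hi ↦ ?_⟩, ?_⟩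
    · rcases le_or_gt i 4 with h4 | h4
      · interval_cases i <;> simp_all
      · exact hbig i h4
    · rw [hspec, r₀, w₁, r₂, w₃, r₄]
      simp [Multiset.filter_cons, Multiset.filter_singleton]
  · have hpos := card_add_lambdaSum_pos hq hgt' (Ring.two_ne_zero h2) h7 h27
    apply cUniformity_powFun_eq_four h2 hq hgt'
    rcases h5 with h | h
    · have := cOmega_four_of_five_square h2 hq hgt' h
      omega
    · have := cOmega_four_of_five_nonsquare h2 hq hgt' h
      omega
  -- This value makes `q + λ - 7` vanish.
  · have hl : lambdaSum K = 7 - Fintype.card K := by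
      rcases hor with h | h
      · rw [lambdaSum_of_card_seven h, h]
        norm_num
      · rw [lambdaSum_of_card_twentyseven h, h]
        · norm_num
        · intro h'
          have := cOmega_four_of_five_nonsquare h2 hq hgt' h'
          omega
    -- If `5` were a square, then `16 ω₄ = q + λ + 1 = 8`, which is impossible; so `5` is a
    -- nonsquare and `ω₄ = 0`.
    rcases h5 with h | h
    · have := cOmega_four_of_five_square h2 hq hgt' h
      omega
    · have := cOmega_four_of_five_nonsquare h2 hq hgt' h
      exact cUniformity_powFun_eq_two h2 hq hgt' h (by omega)
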